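/- **Definitions.** Let $V$ be a seven-dimensional real vector space. A three-form $\varphi\in\Lambda^3V^*$ is a *$\mathrm G_2$-structure* if there is a basis $e_1,\dots,e_7$ of $V$ (an *adapted basis*) with $$\varphi=e^{127}+e^{347}+e^{567}+e^{135}-e^{146}-e^{236}-e^{245},$$ and a *$\mathrm G_2^*$-structure* if there is a basis $f_1,\dots,f_7$ of $V$ (an *adapted basis*) with $$\varphi=-f^{127}-f^{347}+f^{567}+f^{135}-f^{146}-f^{236}-f^{245}.$$ Here $e^1,\dots,e^7$ is the dual basis and $e^{ijk}=e^i\wedge e^j\wedge e^k$. Such a $\varphi$ induces a unique (pseudo-)Euclidean metric $g$ and volume form $\mathrm{vol}$ on $V$ with $$g(v,w)\,\mathrm{vol}=\tfrac16\,(v\lrcorner\varphi)\wedge(w\lrcorner\varphi)\wedge\varphi$$ such that every adapted basis is an oriented orthonormal basis; $g$ is positive definite for a $\mathrm G_2$-structure, while for a $\mathrm G_2^*$-structure the vectors $f_1,\dots,f_4$ of an adapted basis have square $-1$ and $f_5,f_6,f_7$ have square $1$. The Hodge dual $\star_\varphi\varphi\in\Lambda^4V^*$ is defined by $\varphi\wedge\Phi=g(\star_\varphi\varphi,\Phi)\,\mathrm{vol}$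 for all $\Phi\in\Lambda^4V^*$. If $V=\mathfrak g$ is a Lie algebra, $\varphi$ is called *cocalibrated* if $d\star_\varphi\varphi=0$, where $d$ is the exterior derivative on $\Lambda^*\mathfrak g^*$ determined by $(d\alpha)(X,Y)=-\alpha([X,Y])$ on one-forms. For a two-form $\omega$ on $U$, $\mathfrak{sp}(U,\omega)=\{f\in\mathfrak{gl}(U)\mid \omega(fx,y)+\omega(x,fy)=0\ \ \forall x,y\in U\}$. **Theorem.** Let $\mathfrak g$ be a seven-dimensional real Lie algebra with a six-dimensional Abelian ideal $\mathfrak u$. Let $e_7\in\mathfrak g\setminus\mathfrak u$, let $\omega_6\in\Lambda^2\mathfrak u^*$ be a non-degenerate two-form on $\mathfrak u$, let $V_4$ be a four-dimensional subspace of $\mathfrak u$, let $V_2$ be a two-dimensional subspace of $\mathfrak u$ complementary to $V_4$, and let $\omega_4\in\Lambda^2V_4^*$ be a non-degenerate two-form on $V_4$. Then: (a) The following three conditions are equivalent: $\mathfrak g$ admits a cocalibrated $\mathrm G_2$-structure; $\mathfrak g$ admits a cocalibrated $\mathrm G_2^*$-structure such that $\mathfrak u$ is a non-degenerate subspace of $\mathfrak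 g$ with respect to the induced pseudo-Euclidean metric on $\mathfrak g$; $\mathrm{ad}(e_7)|_{\mathfrak u}\in\mathfrak{gl}(\mathfrak u)$ is similar under $\mathrm{GL}(\mathfrak u)$ to an element of $\mathfrak{sp}(\mathfrak u,\omega_6)$. (b) $\mathfrak g$ admits a cocalibrated $\mathrm G_2^*$-structure if and only if $\mathrm{ad}(e_7)|_{\mathfrak u}$ is similar under $\mathrm{GL}(\mathfrak u)$ to an element of $\mathfrak{sp}(\mathfrak u,\omega_6)$ or to an element of $$\Bigl\{f\in\mathfrak{gl}(\mathfrak u)\Bigm| f|_{V_2}=f_2+h,\ f_2\in\mathfrak{gl}(V_2),\ h\in\mathrm{Hom}(V_2,V_4),\quad f|_{V_4}=-\tfrac{\mathrm{tr}(f_2)}2\,\mathrm{id}_{V_4}+f_4,\ f_4\in\mathfrak{sp}(V_4,\omega_4)\Bigr\}.$$ -/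

import Mathlib

/-- The exterior product `α₁ ∧ ⋯ ∧ α_k` of one-forms, i.e. the `k`-form
`(v₁, …, v_k) ↦ det (α_i (v_j))`. -/
def wedgeOneForms {V : Type*} [AddCommGroup V] [Module ℝ V] {k : ℕ}
    (α : Fin k → Module.Dual ℝ V) : V [⋀^Fin k]→ₗ[ℝ] ℝ :=
  (Matrix.detRowAlternating (n := Fin k) (R := ℝ)).compLinearMap (LinearMap.pi α)

/-- The exterior product of a `k`-form and an `l`-form: the signed sum over all
`(k, l)`-shuffles (so that `(α ∧ β) (v, w) = α v * β w - α w * β v` for one-forms). -/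
noncomputable def wedge {V : Type*} [AddCommGroup V] [Module ℝ V] {k l : ℕ}
    (α : V [⋀^Fin k]→ₗ[ℝ] ℝ) (β : V [⋀^Fin l]→ₗ[ℝ] ℝ) : V [⋀^Fin (k + l)]→ₗ[ℝ] ℝ :=
  ((LinearMap.mul' ℝ ℝ).compAlternatingMap (α.domCoprod β)).domDomCongr finSumFinEquiv

/-- For a basis `e₀, …, e₆` of `V` with dual basis `e⁰, …, e⁶`, the `k`-form
`e^{i₁} ∧ ⋯ ∧ e^{i_k}`. -/
noncomputable def basisForm {V : Type*} [AddCommGroup V] [Module ℝ V] {k : ℕ}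
    (e : Module.Basis (Fin 7) ℝ V) (i : Fin k → Fin 7) : V [⋀^Fin k]→ₗ[ℝ] ℝ :=
  wedgeOneForms fun a => e.coord (i a)

/-- The standard three-form
`e^{127} + e^{347} + e^{567} + e^{135} - e^{146} - e^{236} - e^{245}`
of a basis `e₁, …, e₇`; in the code the indices start at `0`. -/
noncomputable def standardG2Form {V : Type*} [AddCommGroup V] [Module ℝ V]
    (e : Module.Basis (Fin 7) ℝ V) : V [⋀^Fin 3]→ₗ[ℝ] ℝ :=
  basisForm e ![0, 1, 6] + basisForm e ![2, 3, 6] + basisForm e ![4, 5, 6]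
    + basisForm e ![0, 2, 4] - basisForm e ![0, 3, 5] - basisForm e ![1, 2, 5]
    - basisForm e ![1, 3, 4]

/-- The standard three-form
`- f^{127} - f^{347} + f^{567} + f^{135} - f^{146} - f^{236} - f^{245}`
of a basis `f₁, …, f₇`; in the code the indices start at `0`. -/
noncomputable def standardG2StarForm {V : Type*} [AddCommGroup V] [Module ℝ V]
    (f : Module.Basis (Fin 7) ℝ V) : V [⋀^Fin 3]→ₗ[ℝ] ℝ :=
  - basisForm f ![0, 1, 6] - basisForm f ![2, 3, 6] + basisForm f ![4, 5, 6]
    + basisForm f ![0, 2, 4] - basisForm f ![0, 3, 5] - basisForm f ![1, 2, 5]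
    - basisForm f ![1, 3, 4]

/-- `φ` is a `G₂`-structure on the (seven-dimensional) real vector space `V`. -/
def IsG2Structure {V : Type*} [AddCommGroup V] [Module ℝ V]
    (φ : V [⋀^Fin 3]→ₗ[ℝ] ℝ) : Prop :=
  ∃ e : Module.Basis (Fin 7) ℝ V, φ = standardG2Form e

/-- `φ` is a `G₂*`-structure on the (seven-dimensional) real vector space `V`. -/
def IsG2StarStructure {V : Type*} [AddCommGroup V] [Module ℝ V]
    (φ : V [⋀^Fin 3]→ₗ[ℝ] ℝ) : Prop :=
  ∃ f : Module.Basis (Fin 7) ℝ V, φ = standardG2StarForm f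

/-- The identity `g(v, w) vol = (1/6) (v ⌟ φ) ∧ (w ⌟ φ) ∧ φ` between a bilinear form `g`,
a seven-form `vol` and a three-form `φ`. -/
def MetricIdentity {V : Type*} [AddCommGroup V] [Module ℝ V]
    (φ : V [⋀^Fin 3]→ₗ[ℝ] ℝ) (g : LinearMap.BilinForm ℝ V) (vol : V [⋀^Fin 7]→ₗ[ℝ] ℝ) : Prop :=
  ∀ v w : V, g v w • vol = (1 / 6 : ℝ) • wedge (wedge (φ.curryLeft v) (φ.curryLeft w)) φ

/-- `g` and `vol` are the Euclidean metric and the volume form induced by the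
`G₂`-structure `φ`: the defining identity holds, and every adapted basis is an oriented
orthonormal basis. -/
def IsInducedByG2 {V : Type*} [AddCommGroup V] [Module ℝ V]
    (φ : V [⋀^Fin 3]→ₗ[ℝ] ℝ) (g : LinearMap.BilinForm ℝ V) (vol : V [⋀^Fin 7]→ₗ[ℝ] ℝ) : Prop :=
  MetricIdentity φ g vol ∧
    ∀ e : Module.Basis (Fin 7) ℝ V, φ = standardG2Form e →
      vol e = 1 ∧ ∀ i j, g (e i) (e j) = if i = j then 1 else 0

/-- `g` and `vol` are the pseudo-Euclidean metric and the volume form induced by the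
`G₂*`-structure `φ`: the defining identity holds, and every adapted basis is an oriented
orthonormal basis, whose first four vectors have square `-1` and whose last three vectors
have square `1`. -/
def IsInducedByG2Star {V : Type*} [AddCommGroup V] [Module ℝ V]
    (φ : V [⋀^Fin 3]→ₗ[ℝ] ℝ) (g : LinearMap.BilinForm ℝ V) (vol : V [⋀^Fin 7]→ₗ[ℝ] ℝ) : Prop :=
  MetricIdentity φ g vol ∧
    ∀ f : Module.Basis (Fin 7) ℝ V, φ = standardG2StarForm f →
      vol f = 1 ∧
        ∀ i j, g (f i) (f j) = if i = j then (if i < 4 then (-1) else 1) else 0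

/-- `Ψ` is the Hodge dual of the `k`-form `ψ` with respect to the (pseudo-)Euclidean metric `g`
and the volume form `vol`, that is `ψ ∧ Φ = g(Ψ, Φ) vol` for all `l`-forms `Φ`, where `k + l` is
the dimension.  The condition is imposed on the forms
`Φ = v₁♭ ∧ ⋯ ∧ v_l♭`, `v♭ = g(v, ·)`, which span all `l`-forms because `g` is non-degenerate, and
for which the induced metric on `l`-forms is `g(Ψ, Φ) = Ψ(v₁, …, v_l)`. -/
def IsHodgeDual {V : Type*} [AddCommGroup V] [Module ℝ V] {k l : ℕ}
    (g : LinearMap.BilinForm ℝ V) (vol : V [⋀^Fin (k + l)]→ₗ[ℝ] ℝ)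
    (ψ : V [⋀^Fin k]→ₗ[ℝ] ℝ) (Ψ : V [⋀^Fin l]→ₗ[ℝ] ℝ) : Prop :=
  ∀ v : Fin l → V, wedge ψ (wedgeOneForms fun a => g (v a)) = Ψ v • vol

/-- The exterior derivative of a `(k+1)`-form on a real Lie algebra (identified with a
left-invariant form), as a function of `k+2` arguments:
`(dω)(x₀, …, x_{k+1}) = ∑_{i<j} (-1)^{i+j} ω([x_i, x_j], x₀, …, x̂_i, …, x̂_j, …, x_{k+1})`.
In particular `(dα)(x, y) = -α([x, y])` for one-forms. -/
noncomputable def lieExtDeriv {L : Type*} [LieRing L] [LieAlgebra ℝ L] {k : ℕ}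
    (ω : L [⋀^Fin (k + 1)]→ₗ[ℝ] ℝ) (x : Fin (k + 2) → L) : ℝ :=
  ∑ j : Fin (k + 2), ∑ i : Fin (k + 1),
    if i.castSucc < j then
      (-1 : ℝ) ^ ((i : ℕ) + (j : ℕ)) *
        ω (Fin.cons ⁅x i.castSucc, x j⁆ fun m : Fin k => x (j.succAbove (i.succAbove m)))
    else 0

/-- A form on a real Lie algebra is closed if its exterior derivative vanishes. -/
def IsClosedForm {L : Type*} [LieRing L] [LieAlgebra ℝ L] {k : ℕ}
    (ω : L [⋀^Fin (k + 1)]→ₗ[ℝ] ℝ) : Prop :=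
  ∀ x : Fin (k + 2) → L, lieExtDeriv ω x = 0

/-- `φ` is a cocalibrated `G₂`-structure on the Lie algebra `L`: its Hodge dual with respect to
the metric and the volume form induced by `φ` is closed. -/
def IsCocalibratedG2 {L : Type*} [LieRing L] [LieAlgebra ℝ L]
    (φ : L [⋀^Fin 3]→ₗ[ℝ] ℝ) : Prop :=
  IsG2Structure φ ∧
    ∃ (g : LinearMap.BilinForm ℝ L) (vol : L [⋀^Fin 7]→ₗ[ℝ] ℝ) (Ψ : L [⋀^Fin 4]→ₗ[ℝ] ℝ),
      IsInducedByG2 φ g vol ∧ IsHodgeDual g vol φ Ψ ∧ IsClosedForm Ψ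

/-- `φ` is a cocalibrated `G₂*`-structure on the Lie algebra `L`: its Hodge dual with respect to
the metric and the volume form induced by `φ` is closed. -/
def IsCocalibratedG2Star {L : Type*} [LieRing L] [LieAlgebra ℝ L]
    (φ : L [⋀^Fin 3]→ₗ[ℝ] ℝ) : Prop :=
  IsG2StarStructure φ ∧
    ∃ (g : LinearMap.BilinForm ℝ L) (vol : L [⋀^Fin 7]→ₗ[ℝ] ℝ) (Ψ : L [⋀^Fin 4]→ₗ[ℝ] ℝ),
      IsInducedByG2Star φ g vol ∧ IsHodgeDual g vol φ Ψ ∧ IsClosedForm Ψ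

/-- The subspace `U` is non-degenerate with respect to the pseudo-Euclidean metric induced by the
`G₂*`-structure `φ`. -/
def IsNondegenerateForG2Star {V : Type*} [AddCommGroup V] [Module ℝ V]
    (φ : V [⋀^Fin 3]→ₗ[ℝ] ℝ) (U : Submodule ℝ V) : Prop :=
  ∃ (g : LinearMap.BilinForm ℝ V) (vol : V [⋀^Fin 7]→ₗ[ℝ] ℝ),
    IsInducedByG2Star φ g vol ∧ (g.restrict U).Nondegenerate

/-- The endomorphism `f` is similar under `GL(U)` to an element of `S`. -/
def IsSimilarToElementOf {U : Type*} [AddCommGroup U] [Module ℝ U]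
    (f : Module.End ℝ U) (S : Set (Module.End ℝ U)) : Prop :=
  ∃ T : U ≃ₗ[ℝ] U, T.conj f ∈ S

/-- The symplectic Lie algebra `sp(U, ω)`: all `f` with `ω(f x, y) + ω(x, f y) = 0`. -/
def symplecticAlgebra {U : Type*} [AddCommGroup U] [Module ℝ U]
    (ω : LinearMap.BilinForm ℝ U) : Set (Module.End ℝ U) :=
  {f | ∀ x y : U, ω (f x) y + ω x (f y) = 0}

/-- For a decomposition `U = V₂ ⊕ V₄` and a two-form `ω₄` on `V₄`, the set of all
endomorphisms `f` of `U` with `f|_{V₂} = f₂ + h` and `f|_{V₄} = - (tr f₂ / 2) id + f₄`, where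
`f₂ ∈ gl(V₂)`, `h ∈ Hom(V₂, V₄)` and `f₄ ∈ sp(V₄, ω₄)`. -/
def lengthTwoStabilizer {U : Type*} [AddCommGroup U] [Module ℝ U]
    (V₂ V₄ : Submodule ℝ U) (ω₄ : LinearMap.BilinForm ℝ V₄) : Set (Module.End ℝ U) :=
  {f | ∃ (f₂ : Module.End ℝ V₂) (h : V₂ →ₗ[ℝ] V₄) (f₄ : Module.End ℝ V₄),
    f₄ ∈ symplecticAlgebra ω₄ ∧
    (∀ x : V₂, f x = (f₂ x : U) + (h x : U)) ∧
    (∀ y : V₄, f y = (-(LinearMap.trace ℝ V₂ f₂ / 2)) • (y : U) + (f₄ y : U))}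

/-! Let `θ` be the one-form with kernel `𝔲` and `θ e₇ = 1`, and let `D = ad e₇`. Since `𝔲` is
Abelian, `[x, y] = θ(x) D y - θ(y) D x`, so `dΨ = -θ ∧ (D · Ψ)` for a four-form `Ψ`, and `Ψ` is
closed exactly when `A = D|_𝔲` annihilates `Ψ|_𝔲` (`lieExtDeriv_four`, `isClosedForm_iff`).

On a six-dimensional space a four-form is, up to a choice of volume, a bivector `B`, and `A`
annihilates the form iff `A B + B Aᵀ = tr(A) B` (`formDerivation_eq_zero_iff`). For `Ψ = ⋆φ` this
bivector is the contraction `n ⌟ φ` with the normal vector `n = θ♯` of `𝔲`, transported by the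
metric (`IsHodgeDual.apply_dual`). Only its rank `2k` then matters.

The double cross product identity controls the rank (`exists_normalForm`): if `g(n, n) ≠ 0`, the
kernel of `n ⌟ φ` is the line through `n` and `k = 3`; if `n` is null, the kernel is totally
isotropic, hence of dimension at most three, and `k ≥ 2`. For `k = 3` the rescaling equation forces
`tr A = 0` and says that `A` is symplectic (`rescalesBivector_three_iff`); for `k = 2` it says that
`A` preserves a four-dimensional subspace and has the block form of part (b)
(`rescalesBivector_two_iff`). In the definite case, and whenever `𝔲` is non-degenerate, `n` is not
null, so only `k = 3` occurs.

Conversely, from a basis of `𝔲` in which `A` rescales the standard bivector of rank six or four, an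
explicit integral change of basis yields an adapted basis of `𝔤` whose three-form has this
contraction (`exists_closed_of_rescalesBivector`). -/

/-! ### Exterior products of one-forms and top-degree forms. -/

section ExteriorProducts

variable {V : Type*} [AddCommGroup V] [Module ℝ V]

/-- Evaluation of alternating forms at a tuple of vectors, as a linear map. -/
def AlternatingMap.evalₗ {k : ℕ} (v : Fin k → V) : (V [⋀^Fin k]→ₗ[ℝ] ℝ) →ₗ[ℝ] ℝ where
  toFun ω := ω v
  map_add' _ _ := rfl
  map_smul' _ _ := rfl

theorem AlternatingMap.finsetSum_apply {k : ℕ} {ι : Type*} (s : Finset ι)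
    (ω : ι → V [⋀^Fin k]→ₗ[ℝ] ℝ) (v : Fin k → V) : (∑ i ∈ s, ω i) v = ∑ i ∈ s, ω i v :=
  map_sum (AlternatingMap.evalₗ v) ω s

theorem wedgeOneForms_apply {k : ℕ} (α : Fin k → Module.Dual ℝ V) (v : Fin k → V) :
    wedgeOneForms α v = (Matrix.of fun i j => α j (v i)).det := rfl

/-- The exterior product as a bilinear map. -/
noncomputable def wedgeₗ (k l : ℕ) :
    (V [⋀^Fin k]→ₗ[ℝ] ℝ) →ₗ[ℝ] (V [⋀^Fin l]→ₗ[ℝ] ℝ) →ₗ[ℝ] (V [⋀^Fin (k + l)]→ₗ[ℝ] ℝ) :=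
  LinearMap.mk₂ ℝ wedge
    (fun _ _ _ => by
      ext; simp [wedge, ← AlternatingMap.domCoprod'_apply, TensorProduct.add_tmul])
    (fun _ _ _ => by
      ext; simp [wedge, ← AlternatingMap.domCoprod'_apply, ← TensorProduct.smul_tmul'])
    (fun _ _ _ => by
      ext; simp [wedge, ← AlternatingMap.domCoprod'_apply, TensorProduct.tmul_add])
    (fun _ _ _ => by
      ext; simp [wedge, ← AlternatingMap.domCoprod'_apply])

theorem wedgeₗ_apply {k l : ℕ} (α : V [⋀^Fin k]→ₗ[ℝ] ℝ) (β : V [⋀^Fin l]→ₗ[ℝ] ℝ) :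
    wedgeₗ k l α β = wedge α β := rfl

theorem wedgeOneForms_eq_alternatization {k : ℕ} (α : Fin k → Module.Dual ℝ V) :
    wedgeOneForms α = MultilinearMap.alternatization
      ((MultilinearMap.mkPiAlgebra ℝ (Fin k) ℝ).compLinearMap α) := by
  ext v
  rw [wedgeOneForms_apply, Matrix.det_apply, MultilinearMap.alternatization_apply]
  rfl

/-- A product of one-forms is the alternatization of a tensor product, and the shuffle product of
two alternatizations is the alternatization of the tensor product, with no factorials. -/
theorem wedge_wedgeOneForms {k l : ℕ} (α : Fin k → Module.Dual ℝ V)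
    (β : Fin l → Module.Dual ℝ V) :
    wedge (wedgeOneForms α) (wedgeOneForms β) = wedgeOneForms (Fin.append α β) := by
  rw [wedge, wedgeOneForms_eq_alternatization, wedgeOneForms_eq_alternatization,
    ← MultilinearMap.domCoprod_alternization]
  ext v
  rw [AlternatingMap.domDomCongr_apply, LinearMap.compAlternatingMap_apply,
    MultilinearMap.alternatization_apply, map_sum, wedgeOneForms_apply, Matrix.det_apply,
    ← Equiv.sum_comp (Equiv.permCongr finSumFinEquiv)]
  refine Finset.sum_congr rfl fun σ _ => ?_
  rw [Equiv.Perm.sign_permCongr, map_zsmul_unit]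
  congr 1
  rw [← Equiv.prod_comp finSumFinEquiv, Fintype.prod_sum_type]
  simp [MultilinearMap.domCoprod_apply]

theorem curryLeft_wedgeOneForms {k : ℕ} (α : Fin (k + 1) → Module.Dual ℝ V) (v : V) :
    (wedgeOneForms α).curryLeft v =
      ∑ p : Fin (k + 1), ((-1) ^ (p : ℕ) * α p v) • wedgeOneForms (α ∘ p.succAbove) := by
  ext w
  rw [AlternatingMap.curryLeft_apply_apply, wedgeOneForms_apply, Matrix.det_succ_row_zero,
    AlternatingMap.finsetSum_apply]
  rfl

/-- The Levi-Civita symbol of a tuple of indices. -/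
def leviCivita {n : ℕ} (f : Fin n → Fin n) : ℤ :=
  ∏ i : Fin n, ∏ j : Fin n,
    if i < j then (if f i < f j then 1 else if f i = f j then 0 else -1) else 1

theorem leviCivita_perm {n : ℕ} (σ : Equiv.Perm (Fin n)) :
    leviCivita σ = (Equiv.Perm.sign σ : ℤ) := by
  rw [Equiv.Perm.sign_eq_prod_prod_Ioi]
  push_cast
  refine Finset.prod_congr rfl fun i _ => ?_
  rw [← Finset.prod_filter_mul_prod_filter_not Finset.univ (fun j => i < j)]
  rw [Finset.prod_congr (s₁ := Finset.univ.filter fun j => ¬ i < j) (g := fun _ => 1) rfl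
    (by intro j hj; simp_all), Finset.prod_const_one, mul_one]
  refine Finset.prod_congr (by ext; simp) fun j hj => ?_
  have hij : i < j := by simpa using hj
  have : σ i ≠ σ j := fun h => hij.ne (σ.injective h)
  simp [hij, this]
  split_ifs <;> rfl

theorem leviCivita_of_not_injective {n : ℕ} {f : Fin n → Fin n} (hf : ¬ f.Injective) :
    leviCivita f = 0 := by
  simp only [Function.Injective, not_forall] at hf
  obtain ⟨a, b, hab, hne⟩ := hf
  rcases lt_or_gt_of_ne hne with h | h
  · exact Finset.prod_eq_zero (Finset.mem_univ a)
      (Finset.prod_eq_zero (Finset.mem_univ b) (by simp [h, hab]))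
  · exact Finset.prod_eq_zero (Finset.mem_univ b)
      (Finset.prod_eq_zero (Finset.mem_univ a) (by simp [h, hab]))

/-- The test for repeated indices comes first so that the finite evaluation in `metricCoeff_eq` can
discard such tuples without expanding the double product. -/
theorem leviCivita_eq_ite {n : ℕ} (f : Fin n → Fin n) :
    leviCivita f = if ∀ i j, i < j → f i ≠ f j then leviCivita f else 0 := by
  split_ifs with h
  · rfl
  · refine leviCivita_of_not_injective fun hf => h fun i j hij hfij => hij.ne (hf hfij)

theorem AlternatingMap.map_comp_eq_leviCivita {M : Type*} [AddCommGroup M] [Module ℝ M] {n : ℕ}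
    (ω : M [⋀^Fin n]→ₗ[ℝ] ℝ) (w : Fin n → M) (f : Fin n → Fin n) :
    ω (w ∘ f) = leviCivita f * ω w := by
  by_cases hf : f.Injective
  · let σ : Equiv.Perm (Fin n) := Equiv.ofBijective f (Finite.injective_iff_bijective.1 hf)
    have h := ω.map_perm w σ
    have h2 := leviCivita_perm σ
    change leviCivita f = _ at h2
    rw [h2]
    change ω (w ∘ f) = _ at h
    rw [h, Units.smul_def, zsmul_eq_mul]
  · have hf' := hf
    simp only [Function.Injective, not_forall] at hf'
    obtain ⟨a, b, hab, hne⟩ := hf'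
    rw [leviCivita_of_not_injective hf, ω.map_eq_zero_of_eq _ (by simp [hab]) hne]
    simp

theorem wedgeOneForms_coord_comp {n : ℕ} (e : Module.Basis (Fin n) ℝ V) (f : Fin n → Fin n) :
    wedgeOneForms (fun a => e.coord (f a)) e = leviCivita f := by
  rw [wedgeOneForms_apply, ← Matrix.det_transpose]
  have h := (Matrix.detRowAlternating (n := Fin n) (R := ℝ)).map_comp_eq_leviCivita
    (1 : Matrix (Fin n) (Fin n) ℝ) f
  change Matrix.det _ = _ * Matrix.det _ at h
  rw [Matrix.det_one, mul_one] at h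
  rw [← h]
  congr 1
  ext i j
  change e.repr (e j) (f i) = (1 : Matrix (Fin n) (Fin n) ℝ) (f i) j
  simp [Matrix.one_apply, Finsupp.single_apply, eq_comm]

theorem AlternatingMap.ext_top {n : ℕ} (e : Module.Basis (Fin n) ℝ V)
    {ω η : V [⋀^Fin n]→ₗ[ℝ] ℝ} (h : ω e = η e) : ω = η := by
  rw [ω.eq_smul_basis_det e, η.eq_smul_basis_det e, h]

end ExteriorProducts

/-! ### The standard three-forms and the metric and volume form they induce. -/

section ModelForms

variable {V : Type*} [AddCommGroup V] [Module ℝ V]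

/-- The index triples occurring in the standard three-forms. -/
def tripleIndex : Fin 7 → Fin 3 → Fin 7 :=
  ![![0, 1, 6], ![2, 3, 6], ![4, 5, 6], ![0, 2, 4], ![0, 3, 5], ![1, 2, 5], ![1, 3, 4]]

/-- The coefficients of the standard `G₂`-form (`δ = 1`) and `G₂*`-form (`δ = -1`). -/
def tripleCoeff (δ : ℤ) : Fin 7 → ℤ := ![δ, δ, 1, 1, -1, -1, -1]

/-- The squares of the vectors of an adapted basis. -/
def metricSign (δ : ℤ) : Fin 7 → ℤ := ![δ, δ, δ, δ, 1, 1, 1]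

/-- The standard `G₂`-form (`δ = 1`) and `G₂*`-form (`δ = -1`) of a basis. -/
noncomputable def modelForm (δ : ℤ) (e : Module.Basis (Fin 7) ℝ V) : V [⋀^Fin 3]→ₗ[ℝ] ℝ :=
  ∑ t, (tripleCoeff δ t : ℝ) • basisForm e (tripleIndex t)

theorem modelForm_one (e : Module.Basis (Fin 7) ℝ V) : modelForm 1 e = standardG2Form e := by
  simp [modelForm, standardG2Form, Fin.sum_univ_succ, tripleCoeff, tripleIndex]
  module

theorem modelForm_neg_one (e : Module.Basis (Fin 7) ℝ V) :
    modelForm (-1) e = standardG2StarForm e := by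
  simp [modelForm, standardG2StarForm, Fin.sum_univ_succ, tripleCoeff, tripleIndex]
  module

/-- The metric for which the basis is orthonormal with signs `metricSign δ`. -/
noncomputable def modelMetric (δ : ℤ) (e : Module.Basis (Fin 7) ℝ V) : LinearMap.BilinForm ℝ V :=
  Matrix.toBilin e (Matrix.diagonal fun i => (metricSign δ i : ℝ))

theorem modelMetric_basis (δ : ℤ) (e : Module.Basis (Fin 7) ℝ V) (i j : Fin 7) :
    modelMetric δ e (e i) (e j) = if i = j then (metricSign δ i : ℝ) else 0 := by
  simp [modelMetric, Matrix.toBilin_apply, Finsupp.single_apply, Matrix.diagonal_apply]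
  grind

/-- The volume form of a basis. -/
noncomputable def basisVol (e : Module.Basis (Fin 7) ℝ V) : V [⋀^Fin 7]→ₗ[ℝ] ℝ :=
  wedgeOneForms e.coord

theorem basisVol_self (e : Module.Basis (Fin 7) ℝ V) : basisVol e e = 1 := by
  rw [basisVol, wedgeOneForms_apply]
  convert Matrix.det_one (n := Fin 7) (R := ℝ)
  ext i j
  simp [Matrix.one_apply, Finsupp.single_apply]

theorem curryLeft_basisForm (e : Module.Basis (Fin 7) ℝ V) {k : ℕ} (I : Fin (k + 1) → Fin 7)
    (a : Fin 7) :
    (basisForm e I).curryLeft (e a) = ∑ p : Fin (k + 1),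
      (((if I p = a then (-1) ^ (p : ℕ) else 0 : ℤ)) : ℝ) • basisForm e (I ∘ p.succAbove) := by
  rw [basisForm, curryLeft_wedgeOneForms]
  refine Finset.sum_congr rfl fun p _ => ?_
  by_cases h : I p = a
  · simp [h]; rfl
  · simp [h]

theorem curryLeft_modelForm (δ : ℤ) (e : Module.Basis (Fin 7) ℝ V) (a : Fin 7) :
    (modelForm δ e).curryLeft (e a) = ∑ t, ∑ p : Fin 3,
      ((tripleCoeff δ t * if tripleIndex t p = a then (-1) ^ (p : ℕ) else 0 : ℤ) : ℝ) •
        basisForm e (tripleIndex t ∘ p.succAbove) := by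
  have : (modelForm δ e).curryLeft = ∑ t, (tripleCoeff δ t : ℝ) •
      (basisForm e (tripleIndex t)).curryLeft := by
    change AlternatingMap.curryLeftLinearMap _ = _
    rw [modelForm, map_sum]
    simp only [map_smul]
    rfl
  rw [this, LinearMap.sum_apply]
  refine Finset.sum_congr rfl fun t _ => ?_
  rw [LinearMap.smul_apply, curryLeft_basisForm, Finset.smul_sum]
  simp only [smul_smul, Int.cast_mul]

/-- The concatenation of the indices of three contracted terms of the standard form. -/
def metricPerm (t : Fin 7) (p : Fin 3) (t' : Fin 7) (p' : Fin 3) (t'' : Fin 7) :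
    Fin (2 + 2 + 3) → Fin 7 :=
  Fin.append (Fin.append (tripleIndex t ∘ p.succAbove) (tripleIndex t' ∘ p'.succAbove))
    (tripleIndex t'')

/-- The sign of `metricPerm`. -/
def metricPermSign (t : Fin 7) (p : Fin 3) (t' : Fin 7) (p' : Fin 3) (t'' : Fin 7) : ℤ :=
  if ∀ i j, i < j → metricPerm t p t' p' t'' i ≠ metricPerm t p t' p' t'' j then
    leviCivita (n := 7) (metricPerm t p t' p' t'') else 0

/-- The integer `(e_a ⌟ φ) ∧ (e_b ⌟ φ) ∧ φ` for a standard three-form `φ`. -/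
def metricCoeff (δ : ℤ) (a b : Fin 7) : ℤ :=
  ∑ t, ∑ p : Fin 3, if tripleIndex t p = a then ∑ t', ∑ p' : Fin 3,
    if tripleIndex t' p' = b then ∑ t'',
      tripleCoeff δ t * (-1) ^ (p : ℕ) * (tripleCoeff δ t' * (-1) ^ (p' : ℕ)) * tripleCoeff δ t'' *
        metricPermSign t p t' p' t'' else 0 else 0

/-- The metric identity on basis vectors is a finite integer computation, carried out for each of
the two signs. -/
theorem metricCoeff_eq {δ : ℤ} (hδ : δ = 1 ∨ δ = -1) (a b : Fin 7) :
    metricCoeff δ a b = if a = b then 6 * metricSign δ a else 0 := by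
  rcases hδ with rfl | rfl
  · revert a b; decide +kernel
  · revert a b; decide +kernel

theorem basisForm_append (e : Module.Basis (Fin 7) ℝ V) {k l : ℕ} (I : Fin k → Fin 7)
    (J : Fin l → Fin 7) :
    wedge (basisForm e I) (basisForm e J) = basisForm e (Fin.append I J) := by
  rw [basisForm, basisForm, wedge_wedgeOneForms, basisForm]
  congr 1
  ext a : 1
  refine Fin.addCases (fun i => ?_) (fun i => ?_) a <;> simp

/-- The degree `N` is kept as a variable because wedge products have degrees such as `2 + 2 + 3`,
which are not syntactically `7`. -/
theorem basisForm_self_of_eq {N : ℕ} (hN : N = 7) (e : Module.Basis (Fin 7) ℝ V)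
    (f : Fin N → Fin 7) (x : Fin N → V) (hx : ∀ i, x i = e (Fin.cast hN i)) :
    basisForm e f x = leviCivita (f ∘ Fin.cast hN.symm) := by
  subst hN
  obtain rfl : x = e := funext hx
  exact wedgeOneForms_coord_comp e f

theorem AlternatingMap.eq_of_apply_basis_eq {N : ℕ} (hN : N = 7) (e : Module.Basis (Fin 7) ℝ V)
    (x : Fin N → V) (hx : ∀ i, x i = e (Fin.cast hN i)) {ω η : V [⋀^Fin N]→ₗ[ℝ] ℝ}
    (h : ω x = η x) : ω = η := by
  subst hN
  obtain rfl : x = e := funext hx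
  exact AlternatingMap.ext_top e h

theorem basisForm_metricPerm (e : Module.Basis (Fin 7) ℝ V) (t : Fin 7) (p : Fin 3) (t' : Fin 7)
    (p' : Fin 3) (t'' : Fin 7) :
    basisForm e (Fin.append (Fin.append (tripleIndex t ∘ p.succAbove)
      (tripleIndex t' ∘ p'.succAbove)) (tripleIndex t'')) e = metricPermSign t p t' p' t'' := by
  rw [basisForm_self_of_eq (N := 2 + 2 + 3) rfl e _ e fun i => rfl, metricPermSign,
    ← leviCivita_eq_ite]
  rfl

theorem sum_mul_sum_mul_sum_rearrange {R ι κ : Type*} [CommRing R] [Fintype ι] [Fintype κ]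
    (c : ι → R) (A B : ι → κ → R) (S : ι → κ → ι → κ → ι → R) :
    ∑ x, c x * ∑ t', ∑ p', B t' p' * ∑ t, ∑ p, A t p * S t p t' p' x =
      ∑ t, ∑ p, ∑ t', ∑ p', ∑ x, A t p * B t' p' * c x * S t p t' p' x := by
  calc _ = ∑ x, ∑ r : ι × κ, ∑ q : ι × κ, A q.1 q.2 * B r.1 r.2 * c x * S q.1 q.2 r.1 r.2 x := by
        simp only [Fintype.sum_prod_type, Finset.mul_sum]
        refine Finset.sum_congr rfl fun x _ => Finset.sum_congr rfl fun t' _ =>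
          Finset.sum_congr rfl fun p' _ => Finset.sum_congr rfl fun t _ =>
          Finset.sum_congr rfl fun p _ => by ring
    _ = ∑ q : ι × κ, ∑ r : ι × κ, ∑ x, A q.1 q.2 * B r.1 r.2 * c x * S q.1 q.2 r.1 r.2 x := by
        rw [Finset.sum_comm]
        refine (Finset.sum_congr rfl fun r _ => Finset.sum_comm).trans ?_
        exact Finset.sum_comm
    _ = _ := by simp only [Fintype.sum_prod_type]

theorem wedge_wedge_modelForm_apply (δ : ℤ) (e : Module.Basis (Fin 7) ℝ V) (a b : Fin 7) :
    wedge (wedge ((modelForm δ e).curryLeft (e a)) ((modelForm δ e).curryLeft (e b)))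
      (modelForm δ e) e = metricCoeff δ a b := by
  rw [curryLeft_modelForm, curryLeft_modelForm]
  conv_lhs =>
    enter [1, 2]
    rw [modelForm]
  simp only [← wedgeₗ_apply, map_sum, LinearMap.sum_apply, map_smul, LinearMap.smul_apply,
    AlternatingMap.finsetSum_apply, AlternatingMap.smul_apply]
  simp only [wedgeₗ_apply, basisForm_append]
  simp only [basisForm_metricPerm, smul_eq_mul]
  rw [metricCoeff]
  push_cast
  rw [sum_mul_sum_mul_sum_rearrange]
  refine Finset.sum_congr rfl fun t _ => Finset.sum_congr rfl fun p _ => ?_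
  split_ifs with h
  · refine Finset.sum_congr rfl fun t' _ => Finset.sum_congr rfl fun p' _ => ?_
    split_ifs with h'
    · rfl
    · simp
  · simp

/-- The bilinear map `(v, w) ↦ α v ∧ β w ∧ γ`, evaluated at a tuple. -/
noncomputable def wedgeBilin {k l m : ℕ} (α : V →ₗ[ℝ] V [⋀^Fin k]→ₗ[ℝ] ℝ)
    (β : V →ₗ[ℝ] V [⋀^Fin l]→ₗ[ℝ] ℝ) (γ : V [⋀^Fin m]→ₗ[ℝ] ℝ) (x : Fin (k + l + m) → V) :
    LinearMap.BilinForm ℝ V :=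
  ((wedgeₗ k l).compl₁₂ α β).compr₂ ((AlternatingMap.evalₗ x).comp ((wedgeₗ (k + l) m).flip γ))

theorem wedgeBilin_apply {k l m : ℕ} (α : V →ₗ[ℝ] V [⋀^Fin k]→ₗ[ℝ] ℝ)
    (β : V →ₗ[ℝ] V [⋀^Fin l]→ₗ[ℝ] ℝ) (γ : V [⋀^Fin m]→ₗ[ℝ] ℝ) (x : Fin (k + l + m) → V) (v w : V) :
    wedgeBilin α β γ x v w = wedge (wedge (α v) (β w)) γ x := rfl

theorem metricIdentity_modelForm {δ : ℤ} (hδ : δ = 1 ∨ δ = -1) (e : Module.Basis (Fin 7) ℝ V) :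
    MetricIdentity (modelForm δ e) (modelMetric δ e) (basisVol e) := by
  have h : wedgeBilin (k := 2) (l := 2) (m := 3) (modelForm δ e).curryLeft
      (modelForm δ e).curryLeft (modelForm δ e) e = (6 : ℝ) • modelMetric δ e := by
    refine LinearMap.BilinForm.ext_basis e fun i j => ?_
    rw [wedgeBilin_apply, wedge_wedge_modelForm_apply, metricCoeff_eq hδ]
    simp only [LinearMap.smul_apply, modelMetric_basis, smul_eq_mul]
    split_ifs <;> simp
  intro v w
  refine AlternatingMap.eq_of_apply_basis_eq (N := 2 + 2 + 3) rfl e e (fun i => rfl) ?_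
  have h2 := congrArg (fun B => B v w) h
  simp only [wedgeBilin_apply, LinearMap.smul_apply, smul_eq_mul] at h2
  have h3 : (modelMetric δ e v w • basisVol e) e = modelMetric δ e v w := by
    rw [AlternatingMap.smul_apply, basisVol_self, smul_eq_mul, mul_one]
  refine Eq.trans h3 (Eq.trans ?_ (AlternatingMap.smul_apply _ _ _).symm)
  rw [h2, smul_eq_mul]
  ring

/-- Two bases adapted to the same form have volume forms differing by a factor `c`, and the metric
identity makes the metrics differ by the inverse factor. Comparing Gram determinants shows `c = 1`.
-/
theorem modelForm_induced {δ : ℤ} (hδ : δ = 1 ∨ δ = -1) (e e' : Module.Basis (Fin 7) ℝ V)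
    (h : modelForm δ e = modelForm δ e') :
    basisVol e e' = 1 ∧
      ∀ i j, modelMetric δ e (e' i) (e' j) = if i = j then (metricSign δ i : ℝ) else 0 := by
  have hδ0 : (δ : ℝ) ^ 2 = 1 := by rcases hδ with rfl | rfl <;> simp
  obtain ⟨c, hc⟩ : ∃ c : ℝ, basisVol e' = c • basisVol e := by
    refine ⟨basisVol e' e, AlternatingMap.ext_top e ?_⟩
    simp [basisVol_self]
  have h1 : c * basisVol e e' = 1 := by
    rw [← basisVol_self e', hc]; rfl
  have hc0 : c ≠ 0 := left_ne_zero_of_mul_eq_one h1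
  have h2 : modelMetric δ e = c • modelMetric δ e' := by
    ext v w
    have h3 := metricIdentity_modelForm hδ e v w
    rw [h, ← metricIdentity_modelForm hδ e' v w, hc] at h3
    have h4 := congrArg (fun ω => ω e) h3
    simpa [basisVol_self, mul_comm] using h4
  have hdiag : ∀ b : Module.Basis (Fin 7) ℝ V,
      LinearMap.BilinForm.toMatrix b (modelMetric δ b) =
        Matrix.diagonal fun i => (metricSign δ i : ℝ) := fun b => by
    rw [modelMetric, ← LinearMap.BilinForm.toMatrix_symm, LinearEquiv.apply_symm_apply]
  have hdet : (Matrix.diagonal fun i => (metricSign δ i : ℝ)).det = 1 := by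
    rw [Matrix.det_diagonal]
    simp only [metricSign, Fin.prod_univ_succ]
    simp
    linear_combination ((δ : ℝ) ^ 2 + 1) * hδ0
  have h5 : basisVol e e' = (e.toMatrix e').det := by
    rw [basisVol, wedgeOneForms_apply, ← Matrix.det_transpose]
    rfl
  have h6 := congrArg Matrix.det (LinearMap.BilinForm.toMatrix_mul_basis_toMatrix e e'
    (modelMetric δ e))
  rw [hdiag, Matrix.det_mul, Matrix.det_mul, Matrix.det_transpose, hdet, h2, map_smul, hdiag,
    Matrix.det_smul, hdet, ← h5] at h6
  simp only [Fintype.card_fin, mul_one] at h6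
  -- With `D = vol_e(e')`, dimension seven gives `D² = c⁷` on determinants, while `c D = 1`.
  have h7 : c ^ 9 = 1 := by
    calc c ^ 9 = c ^ 2 * c ^ 7 := by ring
      _ = (c * basisVol e e') ^ 2 := by rw [← h6]; ring
      _ = 1 := by rw [h1, one_pow]
  have hc1 : c = 1 := by
    have : StrictMono fun x : ℝ => x ^ 9 := Odd.strictMono_pow (by decide)
    exact this.injective (by simpa using h7)
  subst hc1
  refine ⟨by simpa using h1, fun i j => ?_⟩
  rw [h2, one_smul, modelMetric_basis]

/-- A metric and a volume form for which all bases adapted to the standard form are oriented and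
orthonormal. -/
def IsInduced (δ : ℤ) (φ : V [⋀^Fin 3]→ₗ[ℝ] ℝ) (g : LinearMap.BilinForm ℝ V)
    (vol : V [⋀^Fin 7]→ₗ[ℝ] ℝ) : Prop :=
  MetricIdentity φ g vol ∧ ∀ e : Module.Basis (Fin 7) ℝ V, φ = modelForm δ e →
    vol e = 1 ∧ ∀ i j, g (e i) (e j) = if i = j then (metricSign δ i : ℝ) else 0

theorem isInduced_modelForm {δ : ℤ} (hδ : δ = 1 ∨ δ = -1) (e : Module.Basis (Fin 7) ℝ V) :
    IsInduced δ (modelForm δ e) (modelMetric δ e) (basisVol e) :=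
  ⟨metricIdentity_modelForm hδ e, fun e' h => modelForm_induced hδ e e' h⟩

theorem IsInduced.eq_model {δ : ℤ} {e : Module.Basis (Fin 7) ℝ V} {g : LinearMap.BilinForm ℝ V}
    {vol : V [⋀^Fin 7]→ₗ[ℝ] ℝ} (h : IsInduced δ (modelForm δ e) g vol) :
    g = modelMetric δ e ∧ vol = basisVol e := by
  obtain ⟨h1, h2⟩ := h.2 e rfl
  refine ⟨LinearMap.BilinForm.ext_basis e fun i j => ?_, AlternatingMap.ext_top e ?_⟩
  · rw [h2, modelMetric_basis]
  · rw [h1, basisVol_self]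

theorem isInducedByG2_iff (φ : V [⋀^Fin 3]→ₗ[ℝ] ℝ) (g : LinearMap.BilinForm ℝ V)
    (vol : V [⋀^Fin 7]→ₗ[ℝ] ℝ) : IsInducedByG2 φ g vol ↔ IsInduced 1 φ g vol := by
  have h : ∀ i, metricSign 1 i = 1 := by decide
  simp only [IsInducedByG2, IsInduced, modelForm_one, h, Int.cast_one]

theorem isInducedByG2Star_iff (φ : V [⋀^Fin 3]→ₗ[ℝ] ℝ) (g : LinearMap.BilinForm ℝ V)
    (vol : V [⋀^Fin 7]→ₗ[ℝ] ℝ) : IsInducedByG2Star φ g vol ↔ IsInduced (-1) φ g vol := by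
  have h : ∀ i : Fin 7, ((metricSign (-1) i : ℤ) : ℝ) = if i < 4 then (-1) else 1 := by
    intro i; fin_cases i <;> simp [metricSign]
  simp only [IsInducedByG2Star, IsInduced, modelForm_neg_one, h]

end ModelForms

/-! ### The Hodge dual of a standard three-form. -/

section HodgeDual

variable {V : Type*} [AddCommGroup V] [Module ℝ V]

/-- The exterior product of one-forms as an alternating map. -/
noncomputable def wedgeOneFormsAlternating (l : ℕ) :
    Module.Dual ℝ V [⋀^Fin l]→ₗ[ℝ] (V [⋀^Fin l]→ₗ[ℝ] ℝ) :=
  let D : (Fin l → V) → Module.Dual ℝ V [⋀^Fin l]→ₗ[ℝ] ℝ := fun x =>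
    Matrix.detRowAlternating.compLinearMap (LinearMap.pi fun i => Module.Dual.eval ℝ V (x i))
  have h : ∀ α x, wedgeOneForms α x = D x α := fun α x => by
    rw [wedgeOneForms_apply, ← Matrix.det_transpose]; rfl
  { toFun := wedgeOneForms
    map_update_add' := fun α i a b => by
      ext x
      rw [AlternatingMap.add_apply, h, h, h]
      convert (D x).map_update_add α i a b
    map_update_smul' := fun α i c a => by
      ext x
      rw [AlternatingMap.smul_apply, h, h]
      convert (D x).map_update_smul α i c a
    map_eq_zero_of_eq' := fun α i j hij hne => by
      ext x
      rw [h, (D x).map_eq_zero_of_eq α hij hne]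
      rfl }

/-- The form `v ↦ (ψ ∧ v₁♭ ∧ ⋯ ∧ v_l♭) (x)`. -/
noncomputable def hodgeForm {k l : ℕ} (g : LinearMap.BilinForm ℝ V) (ψ : V [⋀^Fin k]→ₗ[ℝ] ℝ)
    (x : Fin (k + l) → V) : V [⋀^Fin l]→ₗ[ℝ] ℝ :=
  (((AlternatingMap.evalₗ x).comp (wedgeₗ k l ψ)).compAlternatingMap
    (wedgeOneFormsAlternating l)).compLinearMap g

theorem hodgeForm_apply {k l : ℕ} (g : LinearMap.BilinForm ℝ V) (ψ : V [⋀^Fin k]→ₗ[ℝ] ℝ)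
    (x : Fin (k + l) → V) (v : Fin l → V) :
    hodgeForm g ψ x v = wedge ψ (wedgeOneForms fun a => g (v a)) x := rfl

/-- Top-degree forms are determined by their value on one basis, so evaluating `ψ ∧ v₁♭ ∧ ⋯ ∧ v_l♭`
on a basis of volume one already defines the dual. -/
theorem exists_isHodgeDual {k l : ℕ} (hkl : k + l = 7) (g : LinearMap.BilinForm ℝ V)
    (ψ : V [⋀^Fin k]→ₗ[ℝ] ℝ) (e : Module.Basis (Fin 7) ℝ V) (x : Fin (k + l) → V)
    (hx : ∀ i, x i = e (Fin.cast hkl i)) (vol : V [⋀^Fin (k + l)]→ₗ[ℝ] ℝ) (hvol : vol x = 1) :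
    ∃ Ψ : V [⋀^Fin l]→ₗ[ℝ] ℝ, IsHodgeDual g vol ψ Ψ := by
  refine ⟨hodgeForm g ψ x, fun v => AlternatingMap.eq_of_apply_basis_eq hkl e x hx ?_⟩
  rw [AlternatingMap.smul_apply, hvol, smul_eq_mul, mul_one, hodgeForm_apply]

theorem exists_isHodgeDual_modelForm (δ : ℤ) (e : Module.Basis (Fin 7) ℝ V) :
    ∃ Ψ : V [⋀^Fin 4]→ₗ[ℝ] ℝ,
      IsHodgeDual (k := 3) (l := 4) (modelMetric δ e) (basisVol e) (modelForm δ e) Ψ :=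
  exists_isHodgeDual (k := 3) (l := 4) rfl _ _ e e (fun _ => rfl) (basisVol e) (basisVol_self e)

theorem IsHodgeDual.wedge_apply {k l : ℕ} {g : LinearMap.BilinForm ℝ V}
    {vol : V [⋀^Fin (k + l)]→ₗ[ℝ] ℝ} {ψ : V [⋀^Fin k]→ₗ[ℝ] ℝ} {Ψ : V [⋀^Fin l]→ₗ[ℝ] ℝ}
    (h : IsHodgeDual g vol ψ Ψ) (v : Fin l → V) (x : Fin (k + l) → V) :
    wedge ψ (wedgeOneForms fun a => g (v a)) x = Ψ v * vol x := by
  rw [h, AlternatingMap.smul_apply, smul_eq_mul]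

/-- The determinant is block triangular: the `β` vanish on the first `k` vectors and give an
identity block on the last `l`. -/
theorem wedge_wedgeOneForms_apply_of_dual {k l : ℕ} (α : Fin k → Module.Dual ℝ V)
    (β : Fin l → Module.Dual ℝ V) (w : Fin (k + l) → V)
    (h0 : ∀ a b, β a (w (Fin.castAdd l b)) = 0)
    (h1 : ∀ a b, β a (w (Fin.natAdd k b)) = if a = b then 1 else 0) :
    wedge (wedgeOneForms α) (wedgeOneForms β) w =
      wedgeOneForms α fun b => w (Fin.castAdd l b) := by
  rw [wedge_wedgeOneForms, wedgeOneForms_apply, wedgeOneForms_apply,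
    ← Matrix.det_submatrix_equiv_self finSumFinEquiv]
  have : (Matrix.of fun i j => (Fin.append α β j) (w i)).submatrix finSumFinEquiv finSumFinEquiv =
      Matrix.fromBlocks (Matrix.of fun i j => α j (w (Fin.castAdd l i))) 0
        (Matrix.of fun i j => α j (w (Fin.natAdd k i))) 1 := by
    ext (i | i) (j | j) <;> simp [h0, h1, Matrix.one_apply, eq_comm]
  rw [this, Matrix.det_fromBlocks_zero₁₂, Matrix.det_one, mul_one]

theorem wedge_modelForm_apply_of_dual (δ : ℤ) (e : Module.Basis (Fin 7) ℝ V) {l : ℕ}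
    (β : Fin l → Module.Dual ℝ V) (w : Fin (3 + l) → V)
    (h0 : ∀ a b, β a (w (Fin.castAdd l b)) = 0)
    (h1 : ∀ a b, β a (w (Fin.natAdd 3 b)) = if a = b then 1 else 0) :
    wedge (modelForm δ e) (wedgeOneForms β) w = modelForm δ e fun b => w (Fin.castAdd l b) := by
  rw [modelForm, ← wedgeₗ_apply, map_sum, LinearMap.sum_apply, AlternatingMap.finsetSum_apply,
    AlternatingMap.finsetSum_apply]
  refine Finset.sum_congr rfl fun t _ => ?_
  rw [map_smul, LinearMap.smul_apply, AlternatingMap.smul_apply, AlternatingMap.smul_apply,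
    wedgeₗ_apply, basisForm, wedge_wedgeOneForms_apply_of_dual _ _ _ h0 h1]

/-- Let `n = w₀, w₁, …, w₆` be a basis and let `v₁, …, v₆` be metrically dual to `w₁, …, w₆` and
orthogonal to `n`.  Then the Hodge dual of a standard three-form `φ` on the `vᵢ` is given by the
two-form `n ⌟ φ` on the `wᵢ`. -/
theorem IsHodgeDual.apply_dual {δ : ℤ} {e : Module.Basis (Fin 7) ℝ V}
    {g : LinearMap.BilinForm ℝ V} {vol : V [⋀^Fin 7]→ₗ[ℝ] ℝ} {Ψ : V [⋀^Fin 4]→ₗ[ℝ] ℝ}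
    (h : IsHodgeDual (k := 3) (l := 4) g vol (modelForm δ e) Ψ) (w : Fin 7 → V) (v : Fin 6 → V)
    (hvw : ∀ i j, g (v i) (w j) = if j = i.succ then 1 else 0) (τ : Equiv.Perm (Fin 6)) :
    Ψ (fun r => v (τ r.succ.succ)) * vol w =
      Equiv.Perm.sign τ * modelForm δ e ![w 0, w (τ 0).succ, w (τ 1).succ] := by
  -- `σ` fixes `0` and acts as `τ` on the other six indices, so that the last four vectors of `w ∘
  -- σ` are those dual to the arguments of `Ψ`.
  let σ : Equiv.Perm (Fin 7) := Equiv.Perm.decomposeFin.symm (0, τ)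
  have hσ : Equiv.Perm.sign σ = Equiv.Perm.sign τ := by simp [σ]
  have hs : ∀ i : Fin 6, σ i.succ = (τ i).succ := fun i => by simp [σ]
  have hs0 : σ 0 = 0 := by simp [σ]
  have h1 := wedge_modelForm_apply_of_dual δ e (l := 4) (fun r => g (v (τ r.succ.succ))) (w ∘ σ)
    (fun a b => by
      rw [Function.comp_apply, hvw, ← hs, if_neg]
      rw [σ.injective.eq_iff]
      intro hab
      have := congrArg Fin.val hab
      simp at this
      omega)
    (fun a b => by
      rw [Function.comp_apply, hvw, ← hs]
      refine if_congr ?_ rfl rfl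
      rw [σ.injective.eq_iff, Fin.ext_iff, Fin.ext_iff]
      simp
      omega)
  have h5 := (h.wedge_apply (fun r => v (τ r.succ.succ)) (w ∘ σ)).symm.trans h1
  have h2 := vol.map_perm w σ
  rw [hσ, Units.smul_def, zsmul_eq_mul] at h2
  have h3 : (fun b : Fin 3 => (w ∘ σ) (Fin.castAdd 4 b)) =
      ![w 0, w (τ 0).succ, w (τ 1).succ] := by
    ext b
    fin_cases b
    · exact congrArg w hs0
    · exact congrArg w (hs 0)
    · exact congrArg w (hs 1)
  rw [h3] at h5
  have h4 : vol (w ∘ σ) = _ := h2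
  rw [h4] at h5
  rw [← h5]
  rcases Int.units_eq_one_or (Equiv.Perm.sign τ) with h6 | h6 <;> simp [h6]

end HodgeDual

/-! ### The exterior derivative in terms of the action of `ad e₇`. -/

section InfinitesimalAction

variable {V : Type*} [AddCommGroup V] [Module ℝ V]

/-- The action of an endomorphism on alternating forms:
`(D · Ψ) (v₀, …, v_k) = ∑ᵢ Ψ (v₀, …, D vᵢ, …, v_k)`. -/
def formDerivation {k : ℕ} (D : Module.End ℝ V) (Ψ : V [⋀^Fin (k + 1)]→ₗ[ℝ] ℝ) :
    V [⋀^Fin (k + 1)]→ₗ[ℝ] ℝ :=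
  AlternatingMap.alternatizeUncurryFin (Ψ.curryLeft.comp D)

theorem formDerivation_apply {k : ℕ} (D : Module.End ℝ V) (Ψ : V [⋀^Fin (k + 1)]→ₗ[ℝ] ℝ)
    (v : Fin (k + 1) → V) :
    formDerivation D Ψ v =
      ∑ p : Fin (k + 1), (-1) ^ (p : ℕ) * Ψ (Fin.cons (D (v p)) (v ∘ p.succAbove)) := by
  rw [formDerivation, AlternatingMap.alternatizeUncurryFin_apply]
  simp only [zsmul_eq_mul, Int.cast_pow, Int.cast_neg, Int.cast_one]
  rfl

theorem formDerivation_apply_update {k : ℕ} (D : Module.End ℝ V) (Ψ : V [⋀^Fin (k + 1)]→ₗ[ℝ] ℝ)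
    (v : Fin (k + 1) → V) :
    formDerivation D Ψ v = ∑ p : Fin (k + 1), Ψ (Function.update v p (D (v p))) := by
  rw [formDerivation_apply]
  refine Finset.sum_congr rfl fun p _ => ?_
  rw [← Fin.insertNth_removeNth, AlternatingMap.map_insertNth,
    zsmul_eq_mul]
  push_cast
  rfl

/-- Both sides run over ordered pairs `(a, s)` of distinct indices, grouped on the left by unordered
pair and on the right by `a`. Terms with `s < a` agree directly; those with `a < s` need a shift of
index, and `hH` says that two indices may be deleted in either order. -/
theorem sum_lt_eq_neg_sum_sum (H : Fin 5 → Fin 5 → Fin 5 → Fin 4 → ℝ)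
    (hH : ∀ a s (i j : Fin 5) (p q : Fin 4), i = q.castSucc → j = p.succ → q ≤ p →
      H a s i p = H a s j q) :
    (∑ j : Fin 5, ∑ i : Fin 4, if i.castSucc < j then
      (-1 : ℝ) ^ ((i : ℕ) + (j : ℕ)) * (H i.castSucc j j i - H j i.castSucc j i) else 0) =
    - ∑ i : Fin 5, (-1 : ℝ) ^ (i : ℕ) * ∑ p : Fin 4, (-1 : ℝ) ^ (p : ℕ) *
      H i (i.succAbove p) i p := by
  have hH' : ∀ a s (p q : Fin 4), q ≤ p → H a s p.succ q = H a s q.castSucc p :=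
    fun a s p q h => (hH a s _ _ p q rfl rfl h).symm
  have h1 : ∀ j i : Fin 5, ∀ p : Fin 4, i = j.succAbove p →
    (-1 : ℝ) ^ (j : ℕ) * ((-1 : ℝ) ^ (p : ℕ) * H j (j.succAbove p) j p) =
    (-1 : ℝ) ^ ((p : ℕ) + (j : ℕ)) * H j i j p := by
    rintro j i p rfl; ring
  simp only [Finset.mul_sum]
  rw [← Finset.sum_neg_distrib]
  simp only [← Finset.sum_neg_distrib]
  have e1 : ∀ j : Fin 5, ∀ i : Fin 4, (if i.castSucc < j then
      (-1 : ℝ) ^ ((i : ℕ) + (j : ℕ)) * (H i.castSucc j j i - H j i.castSucc j i) else 0) =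
      (if i.castSucc < j then (-1 : ℝ) ^ ((i : ℕ) + (j : ℕ)) * H i.castSucc j j i else 0) +
      (if i.castSucc < j then -((-1 : ℝ) ^ (j : ℕ) * ((-1 : ℝ) ^ (i : ℕ) *
        H j (j.succAbove i) j i)) else 0) := by
    intro j i
    split_ifs with h
    · rw [Fin.succAbove_of_castSucc_lt _ _ h]; ring
    · ring
  have e2 : ∀ j : Fin 5, ∀ i : Fin 4, -((-1 : ℝ) ^ (j : ℕ) * ((-1 : ℝ) ^ (i : ℕ) *
        H j (j.succAbove i) j i)) =
      (if j ≤ i.castSucc then (-1 : ℝ) ^ ((i : ℕ) + 1 + (j : ℕ)) * H j i.succ j i else 0) +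
      (if i.castSucc < j then -((-1 : ℝ) ^ (j : ℕ) * ((-1 : ℝ) ^ (i : ℕ) *
        H j (j.succAbove i) j i)) else 0) := by
    intro j i
    rcases lt_or_ge i.castSucc j with h | h
    · rw [if_neg (not_le.2 h), if_pos h, zero_add]
    · rw [if_pos h, if_neg (not_lt.2 h), Fin.succAbove_of_le_castSucc _ _ h]; ring
  rw [Finset.sum_congr rfl fun j _ => Finset.sum_congr rfl fun i _ => e1 j i,
    Finset.sum_congr (f := fun j : Fin 5 => ∑ i : Fin 4, -_) rfl
      fun j _ => Finset.sum_congr rfl fun i _ => e2 j i]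
  simp only [Finset.sum_add_distrib]
  congr 1
  -- The vacuous outer indices, first on the left and last on the right, are split off; both sums
  -- then run over `Fin 4 × Fin 4`.
  rw [Fin.sum_univ_succ, Fin.sum_univ_castSucc (n := 4) (f := fun j : Fin 5 => ∑ i : Fin 4,
    if j ≤ i.castSucc then (-1 : ℝ) ^ ((i : ℕ) + 1 + (j : ℕ)) * H j i.succ j i else 0)]
  have z1 : ∀ i : Fin 4, ¬ i.castSucc < (0 : Fin 5) := fun i => by simp
  have z2 : ∀ i : Fin 4, ¬ Fin.last 4 ≤ i.castSucc := by decide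
  simp only [z1, z2, if_false, Finset.sum_const_zero, zero_add, add_zero]
  rw [Finset.sum_comm]
  refine Finset.sum_congr rfl fun j _ => Finset.sum_congr rfl fun i _ => ?_
  by_cases h : j ≤ i
  · rw [if_pos (Fin.castSucc_lt_succ_iff.2 h), if_pos (Fin.castSucc_le_castSucc_iff.2 h),
      hH' _ _ i j h]
    simp only [Fin.val_succ, Fin.val_castSucc]
    ring
  · rw [if_neg (mt Fin.castSucc_lt_succ_iff.1 h),
      if_neg (mt Fin.castSucc_le_castSucc_iff.1 h)]

variable {L : Type*} [LieRing L] [LieAlgebra ℝ L]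

/-- This is `dΨ = -θ ∧ (D · Ψ)`, evaluated on five vectors. -/
theorem lieExtDeriv_four {D : Module.End ℝ L} {θ : Module.Dual ℝ L}
    (hbr : ∀ x y : L, ⁅x, y⁆ = θ x • D y - θ y • D x) (Ψ : L [⋀^Fin 4]→ₗ[ℝ] ℝ) (x : Fin 5 → L) :
    lieExtDeriv Ψ x =
      - ∑ i : Fin 5, (-1) ^ (i : ℕ) * (θ (x i) * formDerivation D Ψ (x ∘ i.succAbove)) := by
  let G : Fin 5 → Fin 5 → (Fin 3 → Fin 5) → ℝ := fun a s r =>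
    θ (x a) * Ψ (Fin.cons (D (x s)) (x ∘ r))
  have h1 : ∀ (i : Fin 4) (j : Fin 5),
      Ψ (Fin.cons ⁅x i.castSucc, x j⁆ fun m : Fin 3 => x (j.succAbove (i.succAbove m))) =
        G i.castSucc j (j.succAbove ∘ i.succAbove) - G j i.castSucc (j.succAbove ∘ i.succAbove) := by
    intro i j
    rw [hbr]
    change Ψ.curryLeft _ _ = θ _ * Ψ.curryLeft _ _ - θ _ * Ψ.curryLeft _ _
    rw [map_sub, map_smul, map_smul]
    rfl
  have h2 : ∀ i : Fin 5, θ (x i) * formDerivation D Ψ (x ∘ i.succAbove) =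
      ∑ p : Fin 4, (-1) ^ (p : ℕ) * G i (i.succAbove p) (i.succAbove ∘ p.succAbove) := by
    intro i
    rw [formDerivation_apply, Finset.mul_sum]
    refine Finset.sum_congr rfl fun p _ => ?_
    simp only [G, Function.comp_apply]
    rw [mul_left_comm]
    rfl
  have h3 : ∀ i j : Fin 5, ∀ p q : Fin 4, i = q.castSucc → j = p.succ → q ≤ p →
      i.succAbove ∘ p.succAbove = j.succAbove ∘ q.succAbove := by decide
  simp only [h2, lieExtDeriv, h1]
  exact sum_lt_eq_neg_sum_sum (fun a s j p => G a s (j.succAbove ∘ p.succAbove))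
    fun a s i j p q hi hj hqp => congrArg (G a s) (h3 i j p q hi hj hqp)

/-- Since `θ ≠ 0`, the product `θ ∧ β` vanishes iff `β` vanishes on the kernel of `θ`; here `β = D ·
Ψ`. -/
theorem isClosedForm_iff {D : Module.End ℝ L} {θ : Module.Dual ℝ L}
    (hbr : ∀ x y : L, ⁅x, y⁆ = θ x • D y - θ y • D x) (Ψ : L [⋀^Fin 4]→ₗ[ℝ] ℝ)
    (b : Module.Basis (Fin 7) ℝ L) (hb0 : θ (b 0) = 1) (hb : ∀ i : Fin 6, θ (b i.succ) = 0) :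
    IsClosedForm (k := 3) Ψ ↔
      ∀ u : Fin 4 → L, (∀ i, θ (u i) = 0) → formDerivation D Ψ u = 0 := by
  constructor
  · intro h u hu
    have h1 := h (Fin.cons (b 0) u)
    rw [lieExtDeriv_four hbr, Fin.sum_univ_succ] at h1
    simp only [Fin.cons_succ, hu, zero_mul, mul_zero, Finset.sum_const_zero, add_zero] at h1
    simpa [hb0] using h1
  · intro h x
    rw [lieExtDeriv_four hbr]
    -- It suffices to test `θ ∧ (D · Ψ)` on distinct basis vectors: `θ` can only see `b 0`, and then
    -- the other four lie in its kernel.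
    have h2 : AlternatingMap.alternatizeUncurryFin (θ.smulRight (formDerivation D Ψ)) = 0 := by
      refine Module.Basis.ext_alternating b fun I hI => ?_
      rw [AlternatingMap.alternatizeUncurryFin_apply]
      refine Finset.sum_eq_zero fun p _ => ?_
      by_cases hp : I p = 0
      · rw [LinearMap.smulRight_apply, AlternatingMap.smul_apply, h, smul_zero, smul_zero]
        intro i
        obtain ⟨q, hq⟩ := Fin.exists_succ_eq.2 (show I (p.succAbove i) ≠ 0 from fun h0 =>
          Fin.succAbove_ne p i (hI (h0.trans hp.symm)))
        exact (congrArg (fun i => θ (b i)) hq).symm.trans (hb q)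
      · obtain ⟨q, hq⟩ := Fin.exists_succ_eq.2 hp
        rw [LinearMap.smulRight_apply, ← hq, hb, zero_smul]
        simp
    have h3 := congrArg (fun F => F x) h2
    rw [AlternatingMap.alternatizeUncurryFin_apply] at h3
    rw [neg_eq_zero]
    refine Eq.trans (Finset.sum_congr rfl fun i _ => ?_) h3
    rw [LinearMap.smulRight_apply, zsmul_eq_mul]
    simp only [Int.cast_pow, Int.cast_neg, Int.cast_one]
    rfl

end InfinitesimalAction

/-! ### Four-forms in dimension six as bivectors. -/

section BivectorEquation

variable {U : Type*} [AddCommGroup U] [Module ℝ U]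

theorem swap_succ_succ_update {U : Type*} (v : Fin 6 → U) (τ : Equiv.Perm (Fin 6)) (p : Fin 4)
    (q : Fin 6) (hq : q = 0 ∨ q = 1) :
    (fun r : Fin 4 => v ((τ * Equiv.swap q p.succ.succ) r.succ.succ)) =
      Function.update (fun r : Fin 4 => v (τ r.succ.succ)) p (v (τ q)) := by
  ext r
  have hrq : r.succ.succ ≠ q := by
    rcases hq with rfl | rfl
    · exact Fin.succ_ne_zero _
    · exact fun h => Fin.succ_ne_zero r (Fin.succ_injective _ h)
  by_cases h : r = p
  · subst h; simp
  · rw [Function.update_of_ne h, Equiv.Perm.mul_apply, Equiv.swap_apply_of_ne_of_ne hrq]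
    intro h2
    exact h (Fin.succ_injective _ (Fin.succ_injective _ h2))

/-- Expand `A v_j` in the slot of `v_j`. The component along `v_j` contributes to the trace,
components along the other three arguments vanish, and components along the two missing vectors act
as a transposition of `τ`, which gives the entries of `A B` and `B Aᵀ`. -/
theorem formDerivation_apply_perm (v : Module.Basis (Fin 6) ℝ U) (A : Module.End ℝ U)
    (Ψ : U [⋀^Fin 4]→ₗ[ℝ] ℝ) (B : Matrix (Fin 6) (Fin 6) ℝ) (hB0 : ∀ i, B i i = 0)
    (hB : ∀ τ : Equiv.Perm (Fin 6),
      Ψ (fun r => v (τ r.succ.succ)) = Equiv.Perm.sign τ * B (τ 0) (τ 1))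
    (τ : Equiv.Perm (Fin 6)) :
    formDerivation A Ψ (fun r => v (τ r.succ.succ)) = Equiv.Perm.sign τ *
      ((LinearMap.toMatrix v v A).trace • B - LinearMap.toMatrix v v A * B
        - B * (LinearMap.toMatrix v v A).transpose) (τ 0) (τ 1) := by
  set a := LinearMap.toMatrix v v A with ha
  have hA : ∀ j, A (v j) = ∑ q, a (τ q) j • v (τ q) := by
    intro j
    rw [← Equiv.sum_comp τ.symm]
    simp only [Equiv.apply_symm_apply]
    conv_lhs => rw [← v.sum_repr (A (v j))]
    simp [ha, LinearMap.toMatrix_apply]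
  have hne : ∀ r : Fin 4, r.succ.succ ≠ (1 : Fin 6) := fun r h =>
    Fin.succ_ne_zero r (Fin.succ_injective _ h)
  have h0 : ∀ p : Fin 4, Ψ (Function.update (fun r : Fin 4 => v (τ r.succ.succ)) p (v (τ 0))) =
      - (Equiv.Perm.sign τ * B (τ p.succ.succ) (τ 1)) := by
    intro p
    rw [← swap_succ_succ_update v τ p 0 (Or.inl rfl), hB, Equiv.Perm.sign_mul,
      Equiv.Perm.sign_swap (Fin.succ_ne_zero _).symm, Equiv.Perm.mul_apply, Equiv.Perm.mul_apply,
      Equiv.swap_apply_left, Equiv.swap_apply_of_ne_of_ne (by decide) (hne p).symm]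
    simp
  have h1 : ∀ p : Fin 4, Ψ (Function.update (fun r : Fin 4 => v (τ r.succ.succ)) p (v (τ 1))) =
      - (Equiv.Perm.sign τ * B (τ 0) (τ p.succ.succ)) := by
    intro p
    rw [← swap_succ_succ_update v τ p 1 (Or.inr rfl), hB, Equiv.Perm.sign_mul,
      Equiv.Perm.sign_swap (hne p).symm, Equiv.Perm.mul_apply, Equiv.Perm.mul_apply,
      Equiv.swap_apply_left, Equiv.swap_apply_of_ne_of_ne (by decide) (Fin.succ_ne_zero _).symm]
    simp
  have h2 : ∀ p q : Fin 4,
      Ψ (Function.update (fun r : Fin 4 => v (τ r.succ.succ)) p (v (τ q.succ.succ))) =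
      if q = p then Equiv.Perm.sign τ * B (τ 0) (τ 1) else 0 := by
    intro p q
    split_ifs with h
    · subst h
      rw [← hB]
      congr 1
      exact Function.update_eq_self q _
    · refine Ψ.map_eq_zero_of_eq (i := p) (j := q) _ ?_ (Ne.symm h)
      simp [h]
  have hterm : ∀ p : Fin 4,
      Ψ (Function.update (fun r : Fin 4 => v (τ r.succ.succ)) p (A (v (τ p.succ.succ)))) =
      Equiv.Perm.sign τ * (a (τ p.succ.succ) (τ p.succ.succ) * B (τ 0) (τ 1)
        - a (τ 0) (τ p.succ.succ) * B (τ p.succ.succ) (τ 1)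
        - B (τ 0) (τ p.succ.succ) * a (τ 1) (τ p.succ.succ)) := by
    intro p
    rw [hA, Ψ.map_update_sum]
    simp only [Ψ.map_update_smul]
    rw [Fin.sum_univ_succ, Fin.sum_univ_succ]
    simp only [Fin.succ_zero_eq_one, h0, h1, h2]
    simp
    ring
  rw [formDerivation_apply_update, Finset.sum_congr rfl fun p _ => hterm p, ← Finset.mul_sum]
  congr 1
  have ht : a.trace = ∑ q, a (τ q) (τ q) := by
    rw [Matrix.trace, ← Equiv.sum_comp τ]; rfl
  have hl : (a * B) (τ 0) (τ 1) = ∑ q, a (τ 0) (τ q) * B (τ q) (τ 1) := by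
    rw [Matrix.mul_apply, ← Equiv.sum_comp τ]
  have hr : (B * a.transpose) (τ 0) (τ 1) = ∑ q, B (τ 0) (τ q) * a (τ 1) (τ q) := by
    rw [Matrix.mul_apply, ← Equiv.sum_comp τ]; rfl
  rw [Matrix.sub_apply, Matrix.sub_apply, Matrix.smul_apply, ht, hl, hr, smul_eq_mul,
    Finset.sum_sub_distrib, Finset.sum_sub_distrib, ← Finset.sum_mul]
  -- The four slots omit the diagonal entries of `a` at `τ 0` and `τ 1`; in the full trace these
  -- cancel against the diagonal terms of the two matrix products, the remaining extra terms
  -- containing some `B i i = 0`.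
  simp only [Fin.sum_univ_succ (n := 5), Fin.sum_univ_succ (n := 4), Fin.succ_zero_eq_one, hB0]
  ring

/-- An endomorphism annihilates a four-form on a six-dimensional space if and only if it rescales
the corresponding bivector by its trace. -/
theorem formDerivation_eq_zero_iff (v : Module.Basis (Fin 6) ℝ U) (A : Module.End ℝ U)
    (Ψ : U [⋀^Fin 4]→ₗ[ℝ] ℝ) (B : Matrix (Fin 6) (Fin 6) ℝ) (hB0 : ∀ i, B i i = 0)
    (hB : ∀ τ : Equiv.Perm (Fin 6),
      Ψ (fun r => v (τ r.succ.succ)) = Equiv.Perm.sign τ * B (τ 0) (τ 1)) :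
    formDerivation A Ψ = 0 ↔
      LinearMap.toMatrix v v A * B + B * (LinearMap.toMatrix v v A).transpose =
        (LinearMap.toMatrix v v A).trace • B := by
  have key := formDerivation_apply_perm v A Ψ B hB0 hB
  have hs : ∀ τ : Equiv.Perm (Fin 6), ((Equiv.Perm.sign τ : ℤ) : ℝ) ≠ 0 := fun τ => by simp
  have hpair : ∀ i j : Fin 6, i ≠ j → ∃ τ : Equiv.Perm (Fin 6), τ 0 = i ∧ τ 1 = j := by
    intro i j hij
    obtain ⟨τ, hτ⟩ := Equiv.Perm.exists_extending_pair ![(0 : Fin 6), 1] ![i, j]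
      (by decide) (by intro x y; fin_cases x <;> fin_cases y <;> simp [hij, hij.symm])
    exact ⟨τ, hτ 0, hτ 1⟩
  constructor
  · intro h
    -- Composing `τ` with `(0 1)` changes its sign but not the four arguments of `Ψ`. Skewness then
    -- settles the diagonal of the equation, which no `τ` reaches.
    have hskew : B.transpose = -B := by
      ext i j
      by_cases hij : i = j
      · subst hij; simp [hB0]
      obtain ⟨τ, rfl, rfl⟩ := hpair i j hij
      have h1 := hB (τ * Equiv.swap 0 1)
      have h2 : (fun r : Fin 4 => v ((τ * Equiv.swap 0 1 : Equiv.Perm (Fin 6)) r.succ.succ)) =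
          fun r => v (τ r.succ.succ) := by
        ext r
        have hr : (r.succ.succ : Fin 6) ≠ 1 := fun h =>
          Fin.succ_ne_zero r (Fin.succ_injective _ h)
        rw [Equiv.Perm.mul_apply, Equiv.swap_apply_of_ne_of_ne (Fin.succ_ne_zero _) hr]
      rw [h2, hB] at h1
      simp only [Equiv.Perm.sign_mul, Equiv.Perm.sign_swap (show (0 : Fin 6) ≠ 1 by decide),
        Equiv.Perm.mul_apply, Equiv.swap_apply_left, Equiv.swap_apply_right, Units.val_mul,
        Units.val_neg, Units.val_one, Int.cast_mul, Int.cast_neg, Int.cast_one] at h1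
      have := mul_left_cancel₀ (hs τ) (h1.trans (by ring :
        _ = ((Equiv.Perm.sign τ : ℤ) : ℝ) * -B (τ 1) (τ 0)))
      rw [Matrix.transpose_apply, Matrix.neg_apply]
      linarith
    set a := LinearMap.toMatrix v v A
    have hT : (a * B + B * a.transpose - a.trace • B).transpose =
        -(a * B + B * a.transpose - a.trace • B) := by
      simp only [Matrix.transpose_sub, Matrix.transpose_add, Matrix.transpose_mul,
        Matrix.transpose_transpose, Matrix.transpose_smul, hskew]
      simp only [Matrix.neg_mul, Matrix.mul_neg, smul_neg]
      abel
    rw [← sub_eq_zero]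
    ext i j
    by_cases hij : i = j
    · subst hij
      have := congrFun (congrFun hT i) i
      rw [Matrix.transpose_apply, Matrix.neg_apply] at this
      rw [Matrix.zero_apply]
      linarith
    · obtain ⟨τ, rfl, rfl⟩ := hpair i j hij
      have h1 := key τ
      rw [h, AlternatingMap.zero_apply] at h1
      have h2 := (mul_eq_zero.1 h1.symm).resolve_left (hs τ)
      simp only [Matrix.sub_apply, Matrix.add_apply, Matrix.zero_apply] at h2 ⊢
      linarith
  · intro h
    refine Module.Basis.ext_alternating v fun I hI => ?_
    obtain ⟨τ, hτ⟩ := Equiv.Perm.exists_extending_pair (fun r : Fin 4 => (r.succ.succ : Fin 6)) I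
      (fun x y hxy => Fin.succ_injective _ (Fin.succ_injective _ hxy)) hI
    have h1 := key τ
    simp only [hτ] at h1
    rw [h1, sub_sub, h, sub_self]
    simp

end BivectorEquation

/-! ### Normal form of an alternating bilinear form. -/

section AlternatingNormalForm

/-- The entries of the standard alternating form of rank `2 k`. -/
def standardAlt (k i j : ℕ) : ℝ :=
  if Even i ∧ j = i + 1 ∧ j < 2 * k then 1
  else if Even j ∧ i = j + 1 ∧ i < 2 * k then -1 else 0

theorem standardAlt_add_two (k i j : ℕ) :
    standardAlt (k + 1) (i + 2) (j + 2) = standardAlt k i j := by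
  simp only [standardAlt, Nat.even_add, even_two, iff_true]
  congr 1
  · rw [eq_iff_iff]
    constructor <;> rintro ⟨h1, h2, h3⟩ <;> exact ⟨h1, by omega, by omega⟩
  · congr 1
    rw [eq_iff_iff]
    constructor <;> rintro ⟨h1, h2, h3⟩ <;> exact ⟨h1, by omega, by omega⟩

/-- Symplectic Gram–Schmidt: a nonzero form has a pair with `B x y = 1`, the space splits as their
span plus its orthogonal complement, and induction applies to the complement. -/
theorem exists_basis_alternating {V : Type*} [AddCommGroup V] [Module ℝ V]
    [FiniteDimensional ℝ V] (d : ℕ) (hd : Module.finrank ℝ V = d) (B : LinearMap.BilinForm ℝ V)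
    (hB : B.IsAlt) : ∃ (k : ℕ) (b : Module.Basis (Fin d) ℝ V), 2 * k ≤ d ∧
      ∀ i j, B (b i) (b j) = standardAlt k i j := by
  induction d using Nat.strong_induction_on generalizing V with
  | _ d ih =>
  by_cases h0 : B = 0
  · refine ⟨0, Module.finBasisOfFinrankEq ℝ V hd, by omega, fun i j => ?_⟩
    simp [h0, standardAlt]
  obtain ⟨x, y, hxy⟩ : ∃ x y, B x y = 1 := by
    by_contra! hne
    refine h0 (LinearMap.ext₂ fun x y => ?_)
    by_contra hxy
    exact hne x ((B x y)⁻¹ • y) (by simpa using inv_mul_cancel₀ hxy)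
  have hyx : B y x = -1 := by rw [← hB.neg_eq, hxy]
  let f : V →ₗ[ℝ] ℝ × ℝ := (B x).prod (B y)
  let W := LinearMap.ker f
  have hf : Function.Surjective f := by
    rintro ⟨s, t⟩
    refine ⟨s • y - t • x, ?_⟩
    simp [f, hxy, hyx, hB x, hB y]
  obtain ⟨m, hm⟩ : ∃ m, Module.finrank ℝ W = m := ⟨_, rfl⟩
  obtain rfl : d = m + 2 := by
    have := LinearMap.finrank_range_add_finrank_ker f
    rw [LinearMap.range_eq_top.2 hf, finrank_top, hm, hd] at this
    simp at this
    omega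
  obtain ⟨k, b, hk, hb⟩ := ih m (by omega) hm (B.restrict W) (fun z => hB z)
  have hWx : ∀ z : W, B x z = 0 := fun z => congrArg Prod.fst (LinearMap.mem_ker.1 z.2)
  have hWy : ∀ z : W, B y z = 0 := fun z => congrArg Prod.snd (LinearMap.mem_ker.1 z.2)
  let c : Fin (m + 2) → V := Fin.cons x (Fin.cons y fun i => (b i : V))
  have hspan : ⊤ ≤ Submodule.span ℝ (Set.range c) := by
    intro z _
    have hz : z - (B x z • y - B y z • x) ∈ W := by
      rw [LinearMap.mem_ker]
      simp [f, hxy, hyx, hB x, hB y]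
    have hWle : W ≤ Submodule.span ℝ (Set.range c) := by
      have : W = (Submodule.span ℝ (Set.range b)).map W.subtype := by
        rw [b.span_eq, Submodule.map_subtype_top]
      rw [this, Submodule.map_span_le]
      rintro _ ⟨i, rfl⟩
      exact Submodule.subset_span ⟨i.succ.succ, rfl⟩
    have hx : x ∈ Submodule.span ℝ (Set.range c) := Submodule.subset_span ⟨0, rfl⟩
    have hy : y ∈ Submodule.span ℝ (Set.range c) := Submodule.subset_span ⟨1, rfl⟩
    have := Submodule.add_mem _ (hWle hz) (Submodule.sub_mem _
      (Submodule.smul_mem _ (B x z) hy) (Submodule.smul_mem _ (B y z) hx))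
    simpa using this
  let b' := basisOfTopLeSpanOfCardEqFinrank c hspan (by simp [hd])
  have hb' : ∀ i, b' i = c i := fun i => by simp [b']
  refine ⟨k + 1, b', by omega, fun i j => ?_⟩
  rw [hb', hb']
  refine Fin.cases ?_ (fun i => Fin.cases ?_ (fun i => ?_) i) i <;>
    refine Fin.cases ?_ (fun j => Fin.cases ?_ (fun j => ?_) j) j <;>
    simp only [c, Fin.cons_zero, Fin.cons_succ]
  · rw [hB]; simp [standardAlt]
  · rw [hxy]; simp [standardAlt]; omega
  · rw [hWx]; simp [standardAlt]
  · rw [hyx]; simp [standardAlt]; omega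
  · rw [hB]; simp [standardAlt]
  · rw [hWy]; simp [standardAlt]
  · rw [← hB.neg_eq, hWx]; simp [standardAlt]
  · rw [← hB.neg_eq, hWy]; simp [standardAlt]
  · simp only [Fin.val_succ]
    rw [standardAlt_add_two, ← hb]
    rfl

end AlternatingNormalForm

/-! ### The rescaling equation and the symplectic algebra. -/

section StabilizerAlgebras

variable {U : Type*} [AddCommGroup U] [Module ℝ U]

theorem LinearMap.apply_basis_eq_sum {W : Type*} [AddCommGroup W] [Module ℝ W] {m n : ℕ}
    (b : Module.Basis (Fin m) ℝ U) (c : Module.Basis (Fin n) ℝ W) (f : U →ₗ[ℝ] W) (j : Fin m) :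
    f (b j) = ∑ i, LinearMap.toMatrix b c f i j • c i := by
  conv_lhs => rw [← c.sum_repr (f (b j))]
  simp [LinearMap.toMatrix_apply]

/-- The matrix of the standard alternating form of rank `2 k`. -/
def altMatrix (d k : ℕ) : Matrix (Fin d) (Fin d) ℝ := Matrix.of fun i j => standardAlt k i j

/-- `a` rescales the standard bivector of rank `2 k` by its trace. -/
def RescalesBivector (k : ℕ) (a : Matrix (Fin 6) (Fin 6) ℝ) : Prop :=
  a * altMatrix 6 k + altMatrix 6 k * a.transpose = a.trace • altMatrix 6 k

theorem altMatrix_six_three :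
    altMatrix 6 3 = !![0, 1, 0, 0, 0, 0; -1, 0, 0, 0, 0, 0; 0, 0, 0, 1, 0, 0; 0, 0, -1, 0, 0, 0;
      0, 0, 0, 0, 0, 1; 0, 0, 0, 0, -1, 0] := by
  ext i j
  fin_cases i <;> fin_cases j <;> simp [altMatrix, standardAlt, Nat.even_iff]

theorem altMatrix_six_two :
    altMatrix 6 2 = !![0, 1, 0, 0, 0, 0; -1, 0, 0, 0, 0, 0; 0, 0, 0, 1, 0, 0; 0, 0, -1, 0, 0, 0;
      0, 0, 0, 0, 0, 0; 0, 0, 0, 0, 0, 0] := by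
  ext i j
  fin_cases i <;> fin_cases j <;> simp [altMatrix, standardAlt, Nat.even_iff]

theorem altMatrix_four_two :
    altMatrix 4 2 = !![0, 1, 0, 0; -1, 0, 0, 0; 0, 0, 0, 1; 0, 0, -1, 0] := by
  ext i j
  fin_cases i <;> fin_cases j <;> simp [altMatrix, standardAlt, Nat.even_iff]

theorem altMatrix_mul_self : altMatrix 6 3 * altMatrix 6 3 = -1 := by
  rw [altMatrix_six_three]
  ext i j
  fin_cases i <;> fin_cases j <;> simp [Matrix.mul_apply, Fin.sum_univ_succ]

/-- Conjugation by `J`, with `J² = -1`, exchanges the bivector equation and the two-form equation,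
leaving the trace term. If `aᵀ J + J a = t J` with `t = tr a`, multiplying by `J` and taking traces
gives `-2t = -6t`, so `t = 0`. -/
theorem rescalesBivector_three_iff (a : Matrix (Fin 6) (Fin 6) ℝ) :
    RescalesBivector 3 a ↔ a.transpose * altMatrix 6 3 + altMatrix 6 3 * a = 0 := by
  have hJ := altMatrix_mul_self
  rw [RescalesBivector]
  set J := altMatrix 6 3
  have hconj : J * (a * J + J * a.transpose) * J = -(a.transpose * J + J * a) := by
    calc J * (a * J + J * a.transpose) * J = J * a * (J * J) + (J * J) * a.transpose * J := by
          noncomm_ring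
      _ = _ := by rw [hJ]; noncomm_ring
  have hconj' : J * (a.transpose * J + J * a) * J = -(a * J + J * a.transpose) := by
    calc J * (a.transpose * J + J * a) * J = J * a.transpose * (J * J) + (J * J) * a * J := by
          noncomm_ring
      _ = _ := by rw [hJ]; noncomm_ring
  have htr : ((a.transpose * J + J * a) * J).trace = -(2 * a.trace) := by
    rw [Matrix.add_mul, Matrix.trace_add, Matrix.mul_assoc, hJ, Matrix.trace_mul_comm (J * a) J,
      ← Matrix.mul_assoc, hJ]
    simp
    ring
  constructor
  · intro h
    rw [h] at hconj
    have h1 : J * (a.trace • J) * J = -(a.trace • J) := by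
      rw [Matrix.mul_smul, Matrix.smul_mul, hJ, neg_one_mul, smul_neg]
    have h2 : a.transpose * J + J * a = a.trace • J := by
      rw [h1] at hconj
      exact (neg_injective hconj).symm
    rw [h2, Matrix.smul_mul, hJ] at htr
    simp at htr
    have h3 : a.trace = 0 := by linarith
    rw [h2, h3, zero_smul]
  · intro h
    rw [h] at hconj' htr
    simp at htr
    rw [htr, zero_smul]
    rw [Matrix.mul_zero, Matrix.zero_mul, zero_eq_neg] at hconj'
    exact hconj'

theorem mem_symplecticAlgebra_iff {d k : ℕ} (v : Module.Basis (Fin d) ℝ U)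
    (ω : LinearMap.BilinForm ℝ U) (hω : ∀ i j, ω (v i) (v j) = standardAlt k i j)
    (A : Module.End ℝ U) :
    A ∈ symplecticAlgebra ω ↔ (LinearMap.toMatrix v v A).transpose * altMatrix d k +
      altMatrix d k * LinearMap.toMatrix v v A = 0 := by
  set a := LinearMap.toMatrix v v A
  have hA : ∀ j, A (v j) = ∑ i, a i j • v i := LinearMap.apply_basis_eq_sum v v A
  have hb : ∀ i j, ω (A (v i)) (v j) + ω (v i) (A (v j)) =
      (a.transpose * altMatrix d k + altMatrix d k * a) i j := by
    intro i j
    rw [hA, hA, Matrix.add_apply, Matrix.mul_apply, Matrix.mul_apply]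
    simp only [map_sum, LinearMap.sum_apply, map_smul, LinearMap.smul_apply, hω, smul_eq_mul]
    congr 1
    exact Finset.sum_congr rfl fun m _ => mul_comm _ _
  constructor
  · intro h
    ext i j
    rw [← hb, h]
    rfl
  · intro h x y
    have h0 : ω.compLeft A + ω.compRight A = 0 := by
      refine LinearMap.BilinForm.ext_basis v fun i j => ?_
      have := hb i j
      rw [h] at this
      exact this
    exact congrArg (fun β => β x y) h0

theorem toMatrix_conj_equiv {d : ℕ} (u v : Module.Basis (Fin d) ℝ U) (A : Module.End ℝ U) :
    LinearMap.toMatrix u u ((v.equiv u (Equiv.refl _)).conj A) = LinearMap.toMatrix v v A := by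
  ext i j
  have h : ∀ x, u.repr (v.equiv u (Equiv.refl _) x) i = v.repr x i := by
    intro x
    simp [Module.Basis.equiv]
  rw [LinearMap.toMatrix_apply, LinearMap.toMatrix_apply, LinearEquiv.conj_apply_apply, h]
  simp

/-- Similarity to an element of a set of endomorphisms that is described by matrices. -/
theorem isSimilarToElementOf_iff {d : ℕ} (u : Module.Basis (Fin d) ℝ U) (S : Set (Module.End ℝ U))
    (P : Matrix (Fin d) (Fin d) ℝ → Prop) (hS : ∀ A, A ∈ S ↔ P (LinearMap.toMatrix u u A))
    (A : Module.End ℝ U) :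
    IsSimilarToElementOf A S ↔
      ∃ v : Module.Basis (Fin d) ℝ U, P (LinearMap.toMatrix v v A) := by
  constructor
  · rintro ⟨T, hT⟩
    refine ⟨u.map T.symm, ?_⟩
    rw [hS] at hT
    convert hT using 1
    rw [← toMatrix_conj_equiv u (u.map T.symm) A]
    have hT' : (u.map T.symm).equiv u (Equiv.refl _) = T := by
      refine LinearEquiv.toLinearMap_injective ((u.map T.symm).ext fun i => ?_)
      exact (Module.Basis.equiv_apply _ _ _ _).trans (by simp)
    rw [hT']
  · rintro ⟨v, hv⟩
    refine ⟨v.equiv u (Equiv.refl _), ?_⟩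
    rwa [hS, toMatrix_conj_equiv]

theorem isSimilarToElementOf_symplecticAlgebra_iff (hU : Module.finrank ℝ U = 6)
    (ω : LinearMap.BilinForm ℝ U) (hω : ω.IsAlt) (hn : ω.Nondegenerate) (A : Module.End ℝ U) :
    IsSimilarToElementOf A (symplecticAlgebra ω) ↔
      ∃ v : Module.Basis (Fin 6) ℝ U, RescalesBivector 3 (LinearMap.toMatrix v v A) := by
  have : FiniteDimensional ℝ U := Module.finite_of_finrank_eq_succ hU
  obtain ⟨k, u, hk, hu⟩ := exists_basis_alternating 6 hU ω hω
  obtain rfl : k = 3 := by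
    by_contra hk3
    -- If `k < 3`, the last basis vector lies in the radical of `ω`.
    refine u.ne_zero 5 (hn.1 _ fun y => ?_)
    have : ω (u 5) = 0 := u.ext fun j => by
      rw [hu]
      have := j.isLt
      have h1 : ¬ Even 5 := by decide
      have h2 : (5 : Fin 6).val = 5 := rfl
      rw [standardAlt, if_neg (by rw [h2]; tauto), if_neg (by rw [h2]; omega)]
      rfl
    rw [this]; rfl
  exact isSimilarToElementOf_iff u _ _ (fun A => by
    rw [mem_symplecticAlgebra_iff u ω hu, rescalesBivector_three_iff]) A

/-- The first four basis vectors span the support of the bivector, which `a` must preserve. For the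
blocks `a₄` and `a₂`, the trace of the equation gives `tr a₄ = 2 tr a`, hence `tr a = -tr a₂`, and
adding `tr(a₂)/2` to `a₄` makes it symplectic. The block from the last two vectors to the first four
is free. -/
theorem rescalesBivector_two_iff (a : Matrix (Fin 6) (Fin 6) ℝ) :
    RescalesBivector 2 a ↔
      (∀ (i : Fin 2) (j : Fin 4), a (Fin.natAdd 4 i) (Fin.castAdd 2 j) = 0) ∧
      (Matrix.of fun i j : Fin 4 => a (Fin.castAdd 2 i) (Fin.castAdd 2 j) +
          if i = j then (a 4 4 + a 5 5) / 2 else 0).transpose * altMatrix 4 2 +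
        altMatrix 4 2 * (Matrix.of fun i j : Fin 4 => a (Fin.castAdd 2 i) (Fin.castAdd 2 j) +
          if i = j then (a 4 4 + a 5 5) / 2 else 0) = 0 := by
  rw [RescalesBivector, altMatrix_six_two, altMatrix_four_two, ← Matrix.ext_iff, ← Matrix.ext_iff]
  simp only [Matrix.mul_apply, Matrix.add_apply, Matrix.smul_apply, Matrix.transpose_apply,
    Matrix.trace, Matrix.diag_apply, Matrix.zero_apply, Matrix.of_apply, Fin.sum_univ_succ,
    Fin.forall_fin_succ]
  simp
  constructor <;> (simp only [and_imp]; intros; and_intros <;> linarith)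

end StabilizerAlgebras

/-! ### The stabilizer of a bivector of rank four. -/

section LengthTwoStabilizer

variable {U : Type*} [AddCommGroup U] [Module ℝ U]

theorem exists_adapted_basis_of_isCompl {V₂ V₄ : Submodule ℝ U} (hV : IsCompl V₂ V₄)
    (d : Module.Basis (Fin 2) ℝ V₂) (c : Module.Basis (Fin 4) ℝ V₄) :
    ∃ u : Module.Basis (Fin (4 + 2)) ℝ U, (∀ i, u (Fin.castAdd 2 i) = c i) ∧
      ∀ i, u (Fin.natAdd 4 i) = d i := by
  refine ⟨((c.prod d).map (Submodule.prodEquivOfIsCompl V₄ V₂ hV.symm)).reindex finSumFinEquiv,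
    fun i => ?_, fun i => ?_⟩
  · rw [Module.Basis.reindex_apply, show finSumFinEquiv.symm (Fin.castAdd 2 i) = Sum.inl i from
      finSumFinEquiv_symm_apply_castAdd i]
    simp
  · rw [Module.Basis.reindex_apply, show finSumFinEquiv.symm (Fin.natAdd 4 i) = Sum.inr i from
      finSumFinEquiv_symm_apply_natAdd i]
    simp

theorem mem_lengthTwoStabilizer_iff {V₂ V₄ : Submodule ℝ U}
    (d : Module.Basis (Fin 2) ℝ V₂) (c : Module.Basis (Fin 4) ℝ V₄)
    (u : Module.Basis (Fin (4 + 2)) ℝ U) (hc : ∀ i, u (Fin.castAdd 2 i) = c i)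
    (hd : ∀ i, u (Fin.natAdd 4 i) = d i) (ω₄ : LinearMap.BilinForm ℝ V₄)
    (hω₄ : ∀ i j, ω₄ (c i) (c j) = standardAlt 2 i j) (A : Module.End ℝ U) :
    A ∈ lengthTwoStabilizer V₂ V₄ ω₄ ↔ RescalesBivector 2 (LinearMap.toMatrix u u A) := by
  set a := LinearMap.toMatrix u u A with ha
  have hA : ∀ j, A (u j) = ∑ i, a i j • u i := LinearMap.apply_basis_eq_sum u u A
  have hsum : ∀ j, A (u j) = ∑ i : Fin 4, a (Fin.castAdd 2 i) j • (c i : U) +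
      ∑ i : Fin 2, a (Fin.natAdd 4 i) j • (d i : U) := by
    intro j
    rw [hA, Fin.sum_univ_add]
    simp only [hc, hd]
  have hcoord : ∀ (j : Fin 6) (f : Fin 4 → ℝ) (g : Fin 2 → ℝ),
      A (u j) = ∑ i, f i • (c i : U) + ∑ i, g i • (d i : U) →
      (∀ i, a (Fin.castAdd 2 i) j = f i) ∧ ∀ i, a (Fin.natAdd 4 i) j = g i := by
    intro j f g h
    have h1 : A (u j) = ∑ i, Fin.append f g i • u i := by
      rw [h, Fin.sum_univ_add]
      simp only [Fin.append_left, Fin.append_right, hc, hd]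
    have h2 : ∀ i, a i j = Fin.append f g i := fun i => by
      rw [ha, LinearMap.toMatrix_apply, h1, u.repr_sum_self]
    exact ⟨fun i => by rw [h2, Fin.append_left], fun i => by rw [h2, Fin.append_right]⟩
  rw [rescalesBivector_two_iff]
  constructor
  · rintro ⟨f₂, h, f₄, hf₄, h2, h4⟩
    set s := LinearMap.trace ℝ V₂ f₂ / 2 with hs
    have e4 : ∀ j : Fin 4, (∀ i : Fin 4, a (Fin.castAdd 2 i) (Fin.castAdd 2 j) =
        LinearMap.toMatrix c c f₄ i j - if i = j then s else 0) ∧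
        ∀ i : Fin 2, a (Fin.natAdd 4 i) (Fin.castAdd 2 j) = 0 := by
      intro j
      refine hcoord _ _ (fun _ => 0) ?_
      have h5 : (f₄ (c j) : U) = ∑ i, LinearMap.toMatrix c c f₄ i j • (c i : U) := by
        rw [LinearMap.apply_basis_eq_sum c c f₄ j, Submodule.coe_sum]
        rfl
      rw [hc, h4, h5]
      simp [sub_smul, Finset.sum_sub_distrib, ite_smul]
      abel
    have e2 : ∀ j : Fin 2, ∀ i : Fin 2, a (Fin.natAdd 4 i) (Fin.natAdd 4 j) =
        LinearMap.toMatrix d d f₂ i j := by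
      intro j
      refine (hcoord _ (fun i => LinearMap.toMatrix d c h i j) _ ?_).2
      have h5 : (f₂ (d j) : U) = ∑ i, LinearMap.toMatrix d d f₂ i j • (d i : U) := by
        rw [LinearMap.apply_basis_eq_sum d d f₂ j, Submodule.coe_sum]
        rfl
      have h6 : (h (d j) : U) = ∑ i, LinearMap.toMatrix d c h i j • (c i : U) := by
        rw [LinearMap.apply_basis_eq_sum d c h j, Submodule.coe_sum]
        rfl
      rw [hd, h2, h5, h6, add_comm]
    have hs' : (a 4 4 + a 5 5) / 2 = s := by
      rw [hs, LinearMap.trace_eq_matrix_trace ℝ d, Matrix.trace, Fin.sum_univ_two,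
        Matrix.diag_apply, Matrix.diag_apply, ← e2 0 0, ← e2 1 1]
      rfl
    refine ⟨fun i j => (e4 j).2 i, ?_⟩
    rw [mem_symplecticAlgebra_iff c ω₄ hω₄] at hf₄
    have hN : (Matrix.of fun i j : Fin 4 => a (Fin.castAdd 2 i) (Fin.castAdd 2 j) +
        if i = j then (a 4 4 + a 5 5) / 2 else 0) = LinearMap.toMatrix c c f₄ := by
      ext i j
      rw [Matrix.of_apply, (e4 j).1, hs', sub_add_cancel]
    rw [hN]
    exact hf₄
  · rintro ⟨h0, h4⟩
    set N : Matrix (Fin 4) (Fin 4) ℝ := Matrix.of fun i j => a (Fin.castAdd 2 i) (Fin.castAdd 2 j) +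
      if i = j then (a 4 4 + a 5 5) / 2 else 0 with hN
    let M : Matrix (Fin 2) (Fin 2) ℝ := Matrix.of fun i j => a (Fin.natAdd 4 i) (Fin.natAdd 4 j)
    refine ⟨Matrix.toLin d d M,
      Matrix.toLin d c (Matrix.of fun i j => a (Fin.castAdd 2 i) (Fin.natAdd 4 j)),
      Matrix.toLin c c N, ?_, ?_, ?_⟩
    · rw [mem_symplecticAlgebra_iff c ω₄ hω₄, LinearMap.toMatrix_toLin]
      exact h4
    · intro x
      have : A ∘ₗ V₂.subtype = V₂.subtype ∘ₗ Matrix.toLin d d M + V₄.subtype ∘ₗ Matrix.toLin d c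
          (Matrix.of fun i j => a (Fin.castAdd 2 i) (Fin.natAdd 4 j)) := by
        refine d.ext fun j => ?_
        have := hsum (Fin.natAdd 4 j)
        rw [hd] at this
        simp only [LinearMap.add_apply, LinearMap.comp_apply, Submodule.subtype_apply,
          Matrix.toLin_self, Submodule.coe_sum, Submodule.coe_smul, Matrix.of_apply, M]
        rw [this, add_comm]
      exact congrArg (fun F => F x) this
    · intro y
      have htr : LinearMap.trace ℝ V₂ (Matrix.toLin d d M) = a 4 4 + a 5 5 := by
        rw [LinearMap.trace_eq_matrix_trace ℝ d, LinearMap.toMatrix_toLin, Matrix.trace,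
          Fin.sum_univ_two]
        rfl
      rw [htr]
      have : A ∘ₗ V₄.subtype = (-((a 4 4 + a 5 5) / 2)) • V₄.subtype +
          V₄.subtype ∘ₗ Matrix.toLin c c N := by
        refine c.ext fun j => ?_
        have := hsum (Fin.castAdd 2 j)
        rw [hc] at this
        simp only [LinearMap.add_apply, LinearMap.comp_apply, Submodule.subtype_apply,
          Matrix.toLin_self, Submodule.coe_sum, Submodule.coe_smul, Matrix.of_apply, N,
          LinearMap.smul_apply]
        rw [this]
        simp [h0, add_smul, Finset.sum_add_distrib, ite_smul]
      exact congrArg (fun F => F y) this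

theorem isSimilarToElementOf_lengthTwoStabilizer_iff {V₂ V₄ : Submodule ℝ U}
    (hV₄ : Module.finrank ℝ V₄ = 4) (hV₂ : Module.finrank ℝ V₂ = 2) (hV : IsCompl V₂ V₄)
    (ω₄ : LinearMap.BilinForm ℝ V₄) (hω₄ : ω₄.IsAlt) (hn : ω₄.Nondegenerate)
    (A : Module.End ℝ U) :
    IsSimilarToElementOf A (lengthTwoStabilizer V₂ V₄ ω₄) ↔
      ∃ v : Module.Basis (Fin 6) ℝ U, RescalesBivector 2 (LinearMap.toMatrix v v A) := by
  have : FiniteDimensional ℝ V₄ := Module.finite_of_finrank_eq_succ hV₄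
  have : FiniteDimensional ℝ V₂ := Module.finite_of_finrank_eq_succ hV₂
  obtain ⟨k, c, hk, hc⟩ := exists_basis_alternating 4 hV₄ ω₄ hω₄
  obtain rfl : k = 2 := by
    by_contra hk2
    -- If `k < 2`, the last basis vector lies in the radical of `ω₄`.
    refine c.ne_zero 3 (hn.1 _ fun y => ?_)
    have : ω₄ (c 3) = 0 := c.ext fun j => by
      rw [hc]
      have := j.isLt
      have h1 : ¬ Even 3 := by decide
      have h2 : (3 : Fin 4).val = 3 := rfl
      rw [standardAlt, if_neg (by rw [h2]; tauto), if_neg (by rw [h2]; omega)]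
      rfl
    rw [this]; rfl
  obtain ⟨u, hu4, hu2⟩ := exists_adapted_basis_of_isCompl hV
    (Module.finBasisOfFinrankEq ℝ V₂ hV₂) c
  exact isSimilarToElementOf_iff u _ _
    (fun A => mem_lengthTwoStabilizer_iff _ c u hu4 hu2 ω₄ hc A) A

end LengthTwoStabilizer

/-! ### The rank of the contraction of a standard three-form with a vector. -/

section NormalForm

variable {V : Type*} [AddCommGroup V] [Module ℝ V]

theorem modelMetric_apply (δ : ℤ) (e : Module.Basis (Fin 7) ℝ V) (x y : V) :
    modelMetric δ e x y = ∑ i, (metricSign δ i : ℝ) * e.repr x i * e.repr y i := by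
  rw [modelMetric, Matrix.toBilin_apply]
  refine Finset.sum_congr rfl fun i _ => ?_
  rw [Finset.sum_eq_single i]
  · rw [Matrix.diagonal_apply_eq]; ring
  · intro j _ hj
    simp [hj.symm]
  · simp

theorem modelMetric_comm (δ : ℤ) (e : Module.Basis (Fin 7) ℝ V) (x y : V) :
    modelMetric δ e x y = modelMetric δ e y x := by
  simp only [modelMetric_apply]
  exact Finset.sum_congr rfl fun i _ => by ring

theorem metricSign_mul_self {δ : ℤ} (hδ : δ = 1 ∨ δ = -1) (i : Fin 7) :
    (metricSign δ i : ℝ) * metricSign δ i = 1 := by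
  have : ∀ i, metricSign δ i * metricSign δ i = 1 := by
    rcases hδ with rfl | rfl <;> decide
  exact_mod_cast this i

/-- The vector metrically dual to a one-form. -/
noncomputable def sharp (δ : ℤ) (e : Module.Basis (Fin 7) ℝ V) (α : Module.Dual ℝ V) : V :=
  ∑ i, ((metricSign δ i : ℝ) * α (e i)) • e i

theorem modelMetric_sharp {δ : ℤ} (hδ : δ = 1 ∨ δ = -1) (e : Module.Basis (Fin 7) ℝ V)
    (α : Module.Dual ℝ V) (x : V) : modelMetric δ e (sharp δ e α) x = α x := by
  have : modelMetric δ e (sharp δ e α) = α := by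
    refine e.ext fun i => ?_
    rw [sharp]
    simp only [map_sum, map_smul, LinearMap.sum_apply, LinearMap.smul_apply, modelMetric_basis,
      smul_eq_mul]
    rw [Finset.sum_eq_single i (fun j _ hj => by simp [hj]) (by simp)]
    simp only [if_true]
    linear_combination α (e i) * metricSign_mul_self hδ i
  rw [this]

theorem modelForm_apply (δ : ℤ) (e : Module.Basis (Fin 7) ℝ V) (x y z : V) :
    modelForm δ e ![x, y, z] = ∑ t, (tripleCoeff δ t : ℝ) *
      (e.repr x (tripleIndex t 0) * e.repr y (tripleIndex t 1) * e.repr z (tripleIndex t 2)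
      - e.repr x (tripleIndex t 0) * e.repr y (tripleIndex t 2) * e.repr z (tripleIndex t 1)
      - e.repr x (tripleIndex t 1) * e.repr y (tripleIndex t 0) * e.repr z (tripleIndex t 2)
      + e.repr x (tripleIndex t 1) * e.repr y (tripleIndex t 2) * e.repr z (tripleIndex t 0)
      + e.repr x (tripleIndex t 2) * e.repr y (tripleIndex t 0) * e.repr z (tripleIndex t 1)
      - e.repr x (tripleIndex t 2) * e.repr y (tripleIndex t 1) * e.repr z (tripleIndex t 0)) := by
  rw [modelForm, AlternatingMap.finsetSum_apply]
  refine Finset.sum_congr rfl fun t _ => ?_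
  rw [AlternatingMap.smul_apply, basisForm, wedgeOneForms_apply, Matrix.det_fin_three, smul_eq_mul]
  simp

/-- The coordinates of the one-form `φ(n, x, ·)` in terms of the coordinates of `n` and `x`. -/
def crossCoord (δ : ℤ) (N X : Fin 7 → ℝ) : Fin 7 → ℝ :=
  let m : Fin 7 → Fin 7 → ℝ := fun a b => N a * X b - N b * X a
  ![δ * m 1 6 + m 2 4 - m 3 5, -δ * m 0 6 - m 2 5 - m 3 4, δ * m 3 6 - m 0 4 + m 1 5,
    -δ * m 2 6 + m 0 5 + m 1 4, m 5 6 + m 0 2 - m 1 3, -m 4 6 - m 0 3 - m 1 2,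
    δ * m 0 1 + δ * m 2 3 + m 4 5]

theorem modelForm_eq_crossCoord (δ : ℤ) (e : Module.Basis (Fin 7) ℝ V) (n x : V) (j : Fin 7) :
    modelForm δ e ![n, x, e j] = crossCoord δ (e.repr n) (e.repr x) j := by
  simp only [modelForm_apply, Module.Basis.repr_self]
  generalize e.repr n = N
  generalize e.repr x = X
  fin_cases j <;>
  · simp [Fin.sum_univ_succ, tripleCoeff, tripleIndex, crossCoord, Finsupp.single_apply]
    ring

/-- The double cross product identity `n × (n × x) = g(n, x) n - g(n, n) x` in coordinates. -/
theorem crossCoord_crossCoord {δ : ℤ} (hδ : δ = 1 ∨ δ = -1) (N X : Fin 7 → ℝ) (k : Fin 7) :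
    crossCoord δ N (fun j => metricSign δ j * crossCoord δ N X j) k =
      metricSign δ k * ((∑ i, (metricSign δ i : ℝ) * N i * X i) * N k -
        (∑ i, (metricSign δ i : ℝ) * N i * N i) * X k) := by
  rcases hδ with rfl | rfl <;> fin_cases k <;>
  · simp [Fin.sum_univ_succ, crossCoord, metricSign]
    ring

/-- The hypothesis says that the cross product `n × x` vanishes, hence so does `n × (n × x)`. -/
theorem modelMetric_smul_eq_of_kernel {δ : ℤ} (hδ : δ = 1 ∨ δ = -1)
    (e : Module.Basis (Fin 7) ℝ V) {n x : V} (h : ∀ z, modelForm δ e ![n, x, z] = 0) :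
    modelMetric δ e n n • x = modelMetric δ e n x • n := by
  refine e.ext_elem fun k => ?_
  have h1 := crossCoord_crossCoord hδ (e.repr n) (e.repr x) k
  have h0 : ∀ j, (metricSign δ j : ℝ) * crossCoord δ (e.repr n) (e.repr x) j = 0 := fun j => by
    rw [← modelForm_eq_crossCoord, h, mul_zero]
  have hz : crossCoord δ (e.repr n) (fun _ => 0) k = 0 := by
    fin_cases k <;> simp [crossCoord]
  simp only [h0, hz, ← modelMetric_apply] at h1
  have h2 := (mul_eq_zero.1 h1.symm).resolve_left
    (left_ne_zero_of_mul_eq_one (metricSign_mul_self hδ k))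
  simp only [map_smul, Finsupp.smul_apply, smul_eq_mul]
  linarith

/-- For null `n` the previous identity gives `g(n, x) = 0`; with the roles of `n` and `x` exchanged
it reads `g(x, x) n = g(x, n) x = 0`. -/
theorem isotropic_of_kernel {δ : ℤ} (hδ : δ = 1 ∨ δ = -1)
    (e : Module.Basis (Fin 7) ℝ V) {n x : V} (hn0 : n ≠ 0) (hn : modelMetric δ e n n = 0)
    (h : ∀ z, modelForm δ e ![n, x, z] = 0) : modelMetric δ e x x = 0 := by
  have h1 := modelMetric_smul_eq_of_kernel hδ e h
  rw [hn, zero_smul] at h1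
  have h2 := (smul_eq_zero.1 h1.symm).resolve_right hn0
  have h' : ∀ z, modelForm δ e ![x, n, z] = 0 := by
    intro z
    have := (modelForm δ e).map_swap ![n, x, z] (i := 0) (j := 1) (by decide)
    have h3 : ![n, x, z] ∘ Equiv.swap (0 : Fin 3) 1 = ![x, n, z] := by
      ext i; fin_cases i <;> rfl
    rw [h3] at this
    rw [this, h, neg_zero]
  have h4 := modelMetric_smul_eq_of_kernel hδ e h'
  rw [modelMetric_comm δ e x n, h2, zero_smul] at h4
  exact (smul_eq_zero.1 h4).resolve_right hn0

/-- The metric is definite on the span of the first four adapted vectors. This bounds the dimension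
of totally isotropic subspaces by three. -/
theorem eq_zero_of_isotropic {δ : ℤ} (hδ : δ = 1 ∨ δ = -1) (e : Module.Basis (Fin 7) ℝ V) {x : V}
    (h : modelMetric δ e x x = 0) (h4 : e.repr x 4 = 0) (h5 : e.repr x 5 = 0)
    (h6 : e.repr x 6 = 0) : x = 0 := by
  have h1 : e.repr x 0 ^ 2 + e.repr x 1 ^ 2 + e.repr x 2 ^ 2 + e.repr x 3 ^ 2 = 0 := by
    rw [modelMetric_apply] at h
    rcases hδ with rfl | rfl <;>
    · simp [Fin.sum_univ_succ, metricSign] at h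
      simp [h4, h5, h6] at h
      linarith
  have hsq : ∀ a b c d : ℝ, a ^ 2 + b ^ 2 + c ^ 2 + d ^ 2 = 0 → a = 0 := fun a b c d h =>
    pow_eq_zero_iff two_ne_zero |>.1 (by nlinarith [sq_nonneg a, sq_nonneg b, sq_nonneg c, sq_nonneg d])
  have h_0 := hsq _ _ _ _ h1
  have h_1 := hsq (e.repr x 1) (e.repr x 0) (e.repr x 2) (e.repr x 3) (by linarith)
  have h_2 := hsq (e.repr x 2) (e.repr x 0) (e.repr x 1) (e.repr x 3) (by linarith)
  have h_3 := hsq (e.repr x 3) (e.repr x 0) (e.repr x 1) (e.repr x 2) (by linarith)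
  refine e.ext_elem fun i => ?_
  rw [map_zero, Finsupp.zero_apply]
  fin_cases i <;> assumption

theorem modelMetric_one_self_ne_zero (e : Module.Basis (Fin 7) ℝ V) {x : V} (hx : x ≠ 0) :
    modelMetric 1 e x x ≠ 0 := by
  intro h
  refine hx (e.ext_elem fun i => ?_)
  have hs : ∀ i, metricSign 1 i = 1 := by decide
  simp only [modelMetric_apply, hs, Int.cast_one, one_mul] at h
  have := (Finset.sum_eq_zero_iff_of_nonneg fun i _ => mul_self_nonneg (e.repr x i)).1 h i
    (Finset.mem_univ i)
  simpa using this

theorem update_one_vec {M : Type*} (n x y a : M) : Function.update ![n, x, y] 1 a = ![n, a, y] := by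
  ext i; fin_cases i <;> rfl

theorem update_two_vec {M : Type*} (n x y a : M) : Function.update ![n, x, y] 2 a = ![n, x, a] := by
  ext i; fin_cases i <;> rfl

/-- Contraction of a standard three-form with a vector, as a bilinear form. -/
noncomputable def contraction (δ : ℤ) (e : Module.Basis (Fin 7) ℝ V) (n : V) :
    LinearMap.BilinForm ℝ V :=
  LinearMap.mk₂ ℝ (fun x y => modelForm δ e ![n, x, y])
    (fun x x' y => by
      rw [← update_one_vec n x y (x + x'), AlternatingMap.map_update_add, update_one_vec,
        update_one_vec])
    (fun c x y => by
      rw [← update_one_vec n x y (c • x), AlternatingMap.map_update_smul, update_one_vec])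
    (fun x y y' => by
      rw [← update_two_vec n x y (y + y'), AlternatingMap.map_update_add, update_two_vec,
        update_two_vec])
    (fun c x y => by
      rw [← update_two_vec n x y (c • y), AlternatingMap.map_update_smul, update_two_vec])

theorem contraction_apply (δ : ℤ) (e : Module.Basis (Fin 7) ℝ V) (n x y : V) :
    contraction δ e n x y = modelForm δ e ![n, x, y] := rfl

/-- The contraction `n ⌟ φ` is put into normal form on a complement of `n`, itself in the kernel, so
the kernel has dimension `7 - 2k`. It is a line when `n` is not null and totally isotropic
otherwise. -/
theorem exists_normalForm {δ : ℤ} (hδ : δ = 1 ∨ δ = -1) (e : Module.Basis (Fin 7) ℝ V) {n : V}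
    (hn : n ≠ 0) : ∃ (k : ℕ) (w : Module.Basis (Fin 7) ℝ V), (k = 2 ∨ k = 3) ∧
      (modelMetric δ e n n ≠ 0 → k = 3) ∧ w 0 = n ∧
      ∀ i j : Fin 6, modelForm δ e ![w 0, w i.succ, w j.succ] = standardAlt k i j := by
  have hfin : FiniteDimensional ℝ V := e.finiteDimensional_of_finite
  have hV : Module.finrank ℝ V = 7 := by rw [Module.finrank_eq_card_basis e]; simp
  obtain ⟨W, hW⟩ := Submodule.exists_isCompl (Submodule.span ℝ {n})
  have hWr : Module.finrank ℝ W = 6 := by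
    have := Submodule.finrank_add_eq_of_isCompl hW
    rw [finrank_span_singleton hn, hV] at this
    omega
  have halt : ((contraction δ e n).restrict W).IsAlt := fun x =>
    (modelForm δ e).map_eq_zero_of_eq ![n, (x : V), x] (i := 1) (j := 2) rfl (by decide)
  obtain ⟨k, b, hk, hb⟩ := exists_basis_alternating 6 hWr _ halt
  let w : Module.Basis (Fin 7) ℝ V := Module.Basis.mkFinCons n b
    (fun c x hx h => by
      have h1 : c • n ∈ W := by
        rw [eq_neg_of_add_eq_zero_left h]; exact W.neg_mem hx
      have h2 : c • n = 0 := Submodule.disjoint_def.1 hW.disjoint _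
        (Submodule.smul_mem _ _ (Submodule.mem_span_singleton_self n)) h1
      exact (smul_eq_zero.1 h2).resolve_right hn)
    (fun z => by
      obtain ⟨y, hy, x, hx, rfl⟩ := Submodule.mem_sup.1
        (show z ∈ Submodule.span ℝ {n} ⊔ W by rw [hW.sup_eq_top]; trivial)
      obtain ⟨c, rfl⟩ := Submodule.mem_span_singleton.1 hy
      exact ⟨-c, by simpa using hx⟩)
  have hw0 : w 0 = n := by simp [w]
  have hws : ∀ i : Fin 6, w i.succ = b i := fun i => by simp [w]
  have hker : ∀ i : Fin 6, 2 * k ≤ i → ∀ z, modelForm δ e ![n, w i.succ, z] = 0 := by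
    intro i hi z
    have : contraction δ e n (w i.succ) = 0 := by
      refine w.ext fun j => ?_
      rw [LinearMap.zero_apply]
      refine Fin.cases ?_ (fun j => ?_) j
      · rw [hw0]
        exact (modelForm δ e).map_eq_zero_of_eq ![n, w i.succ, n] (i := 0) (j := 2) rfl
          (by decide)
      · rw [hws, hws]
        refine (hb i j).trans ?_
        rw [standardAlt, if_neg (by omega), if_neg (by omega)]
    exact congrArg (fun f => f z) this
  have hk3 : modelMetric δ e n n ≠ 0 → k = 3 := by
    intro hnn
    by_contra hk3
    have h1 := modelMetric_smul_eq_of_kernel hδ e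
      (hker 5 (by change 2 * k ≤ 5; omega))
    have h2 := congrArg (fun x => w.repr x 6) h1
    simp only [map_smul, ← hw0, Finsupp.smul_apply, Module.Basis.repr_self, smul_eq_mul] at h2
    rw [show (Fin.succ 5 : Fin 7) = 6 from rfl, Finsupp.single_eq_same, mul_one, hw0,
      Finsupp.single_eq_of_ne (by decide), mul_zero] at h2
    exact hnn h2
  refine ⟨k, w, ?_, hk3, hw0, fun i j => ?_⟩
  · by_contra hk2
    have hnn : modelMetric δ e n n = 0 := by
      by_contra hnn
      exact hk2 (Or.inr (hk3 hnn))
    -- If `k ≤ 1`, the last four vectors of `w` lie in the kernel. A nontrivial combination of them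
    -- has vanishing coordinates `4, 5, 6`; it is isotropic, hence zero.
    let f : (Fin 4 → ℝ) →ₗ[ℝ] V := Fintype.linearCombination ℝ fun i : Fin 4 => w i.succ.succ.succ
    let F : (Fin 4 → ℝ) →ₗ[ℝ] (Fin 3 → ℝ) :=
      LinearMap.pi fun i => e.coord (![4, 5, 6] i) ∘ₗ f
    have hF : LinearMap.ker F ≠ ⊥ := LinearMap.ker_ne_bot_of_finrank_lt (by simp)
    obtain ⟨t, ht, ht0⟩ := Submodule.exists_mem_ne_zero_of_ne_bot hF
    have hft : f t = ∑ i, t i • w i.succ.succ.succ := Fintype.linearCombination_apply ..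
    have hft0 : f t = 0 := by
      have hFt : ∀ i, F t i = 0 := fun i => congrFun (LinearMap.mem_ker.1 ht) i
      refine eq_zero_of_isotropic hδ e (isotropic_of_kernel hδ e hn hnn fun z => ?_)
        (hFt 0) (hFt 1) (hFt 2)
      rw [← contraction_apply, hft, map_sum, LinearMap.sum_apply]
      refine Finset.sum_eq_zero fun i _ => ?_
      rw [map_smul, LinearMap.smul_apply, contraction_apply, hker _ (by simp; omega), smul_zero]
    refine ht0 (funext fun i => ?_)
    rw [hft] at hft0
    have hli := w.linearIndependent.comp (fun i : Fin 4 => i.succ.succ.succ)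
      (fun i j h => Fin.succ_injective _ (Fin.succ_injective _ (Fin.succ_injective _ h)))
    exact Fintype.linearIndependent_iff.1 hli t hft0 i
  · rw [hw0, hws, hws]
    exact hb i j

end NormalForm

/-! ### Closedness of the Hodge dual on a Lie algebra with an Abelian ideal of codimension one. -/

section CodimensionOneIdeal

variable {𝔤 : Type*} [LieRing 𝔤] [LieAlgebra ℝ 𝔤]

/-- The vectors `x - θ(x) e₇` and `y - θ(y) e₇` lie in `𝔲` and commute; expanding their bracket
gives the formula. -/
theorem exists_dual_of_abelian_ideal (h𝔤 : Module.finrank ℝ 𝔤 = 7)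
    (𝔲 : LieIdeal ℝ 𝔤) (h𝔲 : Module.finrank ℝ 𝔲 = 6) (h𝔲_abelian : IsLieAbelian 𝔲)
    (e₇ : 𝔤) (he₇ : e₇ ∉ 𝔲) :
    ∃ θ : Module.Dual ℝ 𝔤, θ e₇ = 1 ∧ (∀ x, θ x = 0 ↔ x ∈ 𝔲) ∧
      ∀ x y : 𝔤, ⁅x, y⁆ = θ x • LieAlgebra.ad ℝ 𝔤 e₇ y - θ y • LieAlgebra.ad ℝ 𝔤 e₇ x := by
  have hfin : FiniteDimensional ℝ 𝔤 := Module.finite_of_finrank_eq_succ h𝔤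
  obtain ⟨θ', hθ'⟩ := Submodule.exists_le_ker_of_notMem
    (show e₇ ∉ 𝔲.toSubmodule from he₇)
  obtain ⟨hne, hle⟩ := hθ'
  let θ : Module.Dual ℝ 𝔤 := (θ' e₇)⁻¹ • θ'
  have h1 : θ e₇ = 1 := inv_mul_cancel₀ hne
  have hle' : 𝔲.toSubmodule ≤ LinearMap.ker θ := fun x hx => by
    have : θ' x = 0 := hle hx
    simp [θ, this]
  have hker : 𝔲.toSubmodule = LinearMap.ker θ := by
    refine Submodule.eq_of_le_of_finrank_eq hle' ?_
    have h2 := LinearMap.finrank_range_add_finrank_ker θ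
    rw [LinearMap.range_eq_top.2 (LinearMap.surjective (fun h => by simp [h] at h1)), finrank_top,
      h𝔤, Module.finrank_self] at h2
    change Module.finrank ℝ 𝔲 = _
    omega
  have hmem : ∀ x, θ x = 0 ↔ x ∈ 𝔲 := fun x => by
    rw [← LinearMap.mem_ker, ← hker]; rfl
  refine ⟨θ, h1, hmem, fun x y => ?_⟩
  have hx : x - θ x • e₇ ∈ 𝔲 := by rw [← hmem]; simp [h1]
  have hy : y - θ y • e₇ ∈ 𝔲 := by rw [← hmem]; simp [h1]
  have hab : ⁅x - θ x • e₇, y - θ y • e₇⁆ = 0 := by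
    have := h𝔲_abelian.trivial ⟨_, hx⟩ ⟨_, hy⟩
    exact congrArg Subtype.val this
  simp only [lie_sub, sub_lie, lie_smul, smul_lie, lie_self, smul_zero, sub_zero] at hab
  rw [LieAlgebra.ad_apply, LieAlgebra.ad_apply]
  rw [← lie_skew x e₇] at hab
  rw [← sub_eq_zero, ← hab]
  module

/-- The basis `e₇, v₁, …, v₆` of a Lie algebra with an ideal of codimension one. -/
theorem exists_basis_cons (𝔲 : LieIdeal ℝ 𝔤) {θ : Module.Dual ℝ 𝔤} {e₇ : 𝔤} (hθ : θ e₇ = 1)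
    (hmem : ∀ x, θ x = 0 ↔ x ∈ 𝔲) (v : Module.Basis (Fin 6) ℝ 𝔲) :
    ∃ b : Module.Basis (Fin 7) ℝ 𝔤, b 0 = e₇ ∧ ∀ i : Fin 6, b i.succ = v i := by
  let b : Module.Basis (Fin 7) ℝ 𝔤 := Module.Basis.mkFinCons (N := 𝔲.toSubmodule) e₇ v
    (fun c x hx h => by
      have h1 : θ x = 0 := (hmem x).2 hx
      have := congrArg θ h
      simpa [hθ, h1] using this)
    (fun z => ⟨-θ z, (hmem _).1 (by simp [hθ])⟩)
  exact ⟨b, by simp [b], fun i => by simp [b]⟩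

/-- The Hodge dual of a standard three-form is closed if and only if `ad e₇` rescales the bivector
on the ideal determined by the contraction of the three-form with a normal vector. -/
theorem isClosedForm_iff_rescalesBivector (𝔲 : LieIdeal ℝ 𝔤) {θ : Module.Dual ℝ 𝔤} {e₇ : 𝔤}
    (hθ : θ e₇ = 1) (hmem : ∀ x, θ x = 0 ↔ x ∈ 𝔲)
    (hbr : ∀ x y : 𝔤, ⁅x, y⁆ = θ x • LieAlgebra.ad ℝ 𝔤 e₇ y - θ y • LieAlgebra.ad ℝ 𝔤 e₇ x)
    {δ : ℤ} {e : Module.Basis (Fin 7) ℝ 𝔤} {Ψ : 𝔤 [⋀^Fin 4]→ₗ[ℝ] ℝ}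
    (hΨ : IsHodgeDual (k := 3) (l := 4) (modelMetric δ e) (basisVol e) (modelForm δ e) Ψ)
    (v : Module.Basis (Fin 6) ℝ 𝔲) (w : Fin 7 → 𝔤) (hw0 : w 0 ≠ 0)
    (hvw : ∀ i j, modelMetric δ e (v i) (w j) = if j = i.succ then 1 else 0) {k : ℕ}
    (hw : ∀ i j : Fin 6, modelForm δ e ![w 0, w i.succ, w j.succ] = standardAlt k i j) :
    IsClosedForm (k := 3) Ψ ↔
      RescalesBivector k (LinearMap.toMatrix v v (LieModule.toEnd ℝ 𝔤 𝔲 e₇)) := by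
  set A := LieModule.toEnd ℝ 𝔤 𝔲 e₇
  obtain ⟨b, hb0, hbs⟩ := exists_basis_cons 𝔲 hθ hmem v
  -- Pairing a linear relation among the `w j` with the `v i` kills all coefficients except that of
  -- `w 0 ≠ 0`.
  have hvol : basisVol e w ≠ 0 := by
    have hli : LinearIndependent ℝ w := by
      rw [Fintype.linearIndependent_iff]
      intro t ht
      have hts : ∀ i : Fin 6, t i.succ = 0 := fun i => by
        have := congrArg (modelMetric δ e (v i)) ht
        simpa [hvw] using this
      rw [Fin.sum_univ_succ] at ht
      simp only [hts, zero_smul, Finset.sum_const_zero, add_zero] at ht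
      exact Fin.cases ((smul_eq_zero.1 ht).resolve_right hw0) hts
    obtain ⟨w', rfl⟩ : ∃ w' : Module.Basis (Fin 7) ℝ 𝔤, ⇑w' = w :=
      ⟨basisOfLinearIndependentOfCardEqFinrank hli (by rw [Module.finrank_eq_card_basis e]),
        coe_basisOfLinearIndependentOfCardEqFinrank _ _⟩
    intro h
    have h1 : basisVol e = 0 := AlternatingMap.ext_top w' h
    have h2 := basisVol_self e
    rw [h1] at h2
    exact zero_ne_one h2
  let ι : 𝔲 →ₗ[ℝ] 𝔤 := 𝔲.toSubmodule.subtype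
  have h1 : IsClosedForm (k := 3) Ψ ↔ formDerivation A (Ψ.compLinearMap ι) = 0 := by
    have hder : ∀ u : Fin 4 → 𝔲, formDerivation A (Ψ.compLinearMap ι) u =
        formDerivation (LieAlgebra.ad ℝ 𝔤 e₇) Ψ fun i => (u i : 𝔤) := by
      intro u
      rw [formDerivation_apply, formDerivation_apply]
      refine Finset.sum_congr rfl fun p _ => ?_
      rw [AlternatingMap.compLinearMap_apply]
      congr 2
      ext i
      refine Fin.cases rfl (fun i => rfl) i
    rw [isClosedForm_iff hbr Ψ b (by rw [hb0, hθ])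
      (fun i => by rw [hbs]; exact (hmem _).2 (v i).2)]
    constructor
    · intro h
      ext u
      rw [hder]
      exact h _ fun i => (hmem _).2 (u i).2
    · intro h u hu
      rw [← hder fun i => ⟨u i, (hmem _).1 (hu i)⟩, h]
      rfl
  -- The bivector of `Ψ|_𝔲` is the standard one divided by `vol(w)`; the equation is homogeneous, so
  -- the factor drops out.
  rw [h1, formDerivation_eq_zero_iff v A _ ((basisVol e w)⁻¹ • altMatrix 6 k)]
  · rw [RescalesBivector, Matrix.mul_smul, Matrix.smul_mul, ← smul_add, smul_comm]
    exact (smul_right_injective _ (inv_ne_zero hvol)).eq_iff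
  · intro i
    rw [Matrix.smul_apply, altMatrix, Matrix.of_apply, standardAlt, if_neg (by omega),
      if_neg (by omega), smul_zero]
  · intro τ
    have h2 := hΨ.apply_dual w (fun i => (v i : 𝔤)) hvw τ
    rw [hw] at h2
    rw [Matrix.smul_apply, smul_eq_mul, mul_left_comm, eq_inv_mul_iff_mul_eq₀ hvol, mul_comm]
    exact h2

/-- Extend the normal vector `n = θ♯` to a basis `w` normalizing `n ⌟ φ`, and take for `v` the
metric duals of the remaining coordinate forms. -/
theorem exists_rescalesBivector_of_closed (𝔲 : LieIdeal ℝ 𝔤) {θ : Module.Dual ℝ 𝔤} {e₇ : 𝔤}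
    (hθ : θ e₇ = 1) (hmem : ∀ x, θ x = 0 ↔ x ∈ 𝔲)
    (hbr : ∀ x y : 𝔤, ⁅x, y⁆ = θ x • LieAlgebra.ad ℝ 𝔤 e₇ y - θ y • LieAlgebra.ad ℝ 𝔤 e₇ x)
    (h𝔲 : Module.finrank ℝ 𝔲 = 6)
    {δ : ℤ} (hδ : δ = 1 ∨ δ = -1) {e : Module.Basis (Fin 7) ℝ 𝔤} {Ψ : 𝔤 [⋀^Fin 4]→ₗ[ℝ] ℝ}
    (hΨ : IsHodgeDual (k := 3) (l := 4) (modelMetric δ e) (basisVol e) (modelForm δ e) Ψ)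
    (hcl : IsClosedForm (k := 3) Ψ) :
    ∃ (k : ℕ) (v : Module.Basis (Fin 6) ℝ 𝔲), (k = 2 ∨ k = 3) ∧
      (modelMetric δ e (sharp δ e θ) (sharp δ e θ) ≠ 0 → k = 3) ∧
      RescalesBivector k (LinearMap.toMatrix v v (LieModule.toEnd ℝ 𝔤 𝔲 e₇)) := by
  have hn : sharp δ e θ ≠ 0 := fun h => by
    have := modelMetric_sharp hδ e θ e₇
    rw [h, hθ] at this
    simp at this
  obtain ⟨k, w, hk, hk3, hw0, hw⟩ := exists_normalForm hδ e hn
  -- `θ(v i) = g(n, v i)` is the coordinate `i + 1` of `w 0 = n`, which is zero.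
  have hv𝔲 : ∀ i : Fin 6, sharp δ e (w.coord i.succ) ∈ 𝔲 := fun i => by
    rw [← hmem, ← modelMetric_sharp hδ e θ, modelMetric_comm, modelMetric_sharp hδ, ← hw0]
    simp
  let v' : Fin 6 → 𝔲 := fun i => ⟨sharp δ e (w.coord i.succ), hv𝔲 i⟩
  have hvw : ∀ i j, modelMetric δ e (v' i) (w j) = if j = i.succ then 1 else 0 := fun i j => by
    change modelMetric δ e (sharp δ e (w.coord i.succ)) (w j) = _
    rw [modelMetric_sharp hδ]
    simp [Finsupp.single_apply]
  have hli : LinearIndependent ℝ v' := by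
    rw [Fintype.linearIndependent_iff]
    intro t ht i
    have h1 := congrArg (fun x : 𝔲 => modelMetric δ e (x : 𝔤) (w i.succ)) ht
    simpa [hvw] using h1
  let v := basisOfLinearIndependentOfCardEqFinrank hli (by rw [h𝔲]; rfl)
  have hv : ∀ i, v i = v' i := fun i => by simp [v]
  refine ⟨k, v, hk, hk3, ?_⟩
  rw [← isClosedForm_iff_rescalesBivector 𝔲 hθ hmem hbr hΨ v w (by rwa [hw0])
    (fun i j => by rw [hv, hvw]) hw]
  exact hcl

end CodimensionOneIdeal

/-! ### Bases with integral coordinates. -/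

section IntegralBases

variable {V : Type*} [AddCommGroup V] [Module ℝ V]

theorem exists_basis_of_intMatrix (b : Module.Basis (Fin 7) ℝ V)
    (E P : Matrix (Fin 7) (Fin 7) ℤ) (hPE : P * E = 1) :
    ∃ e : Module.Basis (Fin 7) ℝ V, ∀ i, b i = ∑ a, (P i a : ℝ) • e a := by
  let e : Fin 7 → V := fun a => ∑ j, (E a j : ℝ) • b j
  have hb : ∀ i, b i = ∑ a, (P i a : ℝ) • e a := by
    intro i
    simp only [e, Finset.smul_sum, smul_smul]
    rw [Finset.sum_comm]
    simp only [← Finset.sum_smul, ← Int.cast_mul, ← Int.cast_sum, ← Matrix.mul_apply, hPE]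
    simp [Matrix.one_apply]
  have hspan : ⊤ ≤ Submodule.span ℝ (Set.range e) := by
    rw [← b.span_eq, Submodule.span_le]
    rintro _ ⟨i, rfl⟩
    rw [hb]
    exact Submodule.sum_mem _ fun a _ => Submodule.smul_mem _ _ (Submodule.subset_span ⟨a, rfl⟩)
  refine ⟨basisOfTopLeSpanOfCardEqFinrank e hspan (by rw [Module.finrank_eq_card_basis b]),
    fun i => ?_⟩
  rw [coe_basisOfTopLeSpanOfCardEqFinrank]
  exact hb i

/-- The value of a standard three-form on vectors with integral coordinates. -/
def modelFormInt (δ : ℤ) (x y z : Fin 7 → ℤ) : ℤ :=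
  ∑ t, tripleCoeff δ t *
      (x (tripleIndex t 0) * y (tripleIndex t 1) * z (tripleIndex t 2)
      - x (tripleIndex t 0) * y (tripleIndex t 2) * z (tripleIndex t 1)
      - x (tripleIndex t 1) * y (tripleIndex t 0) * z (tripleIndex t 2)
      + x (tripleIndex t 1) * y (tripleIndex t 2) * z (tripleIndex t 0)
      + x (tripleIndex t 2) * y (tripleIndex t 0) * z (tripleIndex t 1)
      - x (tripleIndex t 2) * y (tripleIndex t 1) * z (tripleIndex t 0))

/-- The product of vectors with integral coordinates. -/
def modelMetricInt (δ : ℤ) (x y : Fin 7 → ℤ) : ℤ := ∑ i, metricSign δ i * x i * y i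

/-- The integral version of `standardAlt`. -/
def standardAltInt (k i j : ℕ) : ℤ :=
  if Even i ∧ j = i + 1 ∧ j < 2 * k then 1
  else if Even j ∧ i = j + 1 ∧ i < 2 * k then -1 else 0

theorem standardAltInt_cast (k i j : ℕ) : (standardAltInt k i j : ℝ) = standardAlt k i j := by
  rw [standardAltInt, standardAlt]
  split_ifs <;> simp

/-- The vector with given integral coordinates. -/
noncomputable def intVector (e : Module.Basis (Fin 7) ℝ V) (x : Fin 7 → ℤ) : V :=
  ∑ a, (x a : ℝ) • e a

theorem repr_intVector (e : Module.Basis (Fin 7) ℝ V) (x : Fin 7 → ℤ) (a : Fin 7) :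
    e.repr (intVector e x) a = x a :=
  congrFun (e.repr_sum_self fun a => (x a : ℝ)) a

theorem modelForm_intVector (δ : ℤ) (e : Module.Basis (Fin 7) ℝ V) (x y z : Fin 7 → ℤ) :
    modelForm δ e ![intVector e x, intVector e y, intVector e z] = modelFormInt δ x y z := by
  rw [modelForm_apply, modelFormInt]
  simp only [repr_intVector]
  push_cast
  rfl

theorem modelMetric_intVector (δ : ℤ) (e : Module.Basis (Fin 7) ℝ V) (x y : Fin 7 → ℤ) :
    modelMetric δ e (intVector e x) (intVector e y) = modelMetricInt δ x y := by
  rw [modelMetric_apply, modelMetricInt]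
  simp only [repr_intVector]
  push_cast
  rfl

end IntegralBases

/-! ### Cocalibrated structures from a rescaled bivector. -/

section Constructions

variable {𝔤 : Type*} [LieRing 𝔤] [LieAlgebra ℝ 𝔤]

/-- Reduces the construction to integer matrices: the rows of `P` are the coordinates of `e₇, v₁, …,
v₆` in the sought adapted basis, `E` inverts `P`, and the rows of `M` are the normal vector and the
vectors dual to the `v i`. -/
theorem exists_closed_of_rescalesBivector (𝔲 : LieIdeal ℝ 𝔤) {θ : Module.Dual ℝ 𝔤} {e₇ : 𝔤}
    (hθ : θ e₇ = 1) (hmem : ∀ x, θ x = 0 ↔ x ∈ 𝔲)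
    (hbr : ∀ x y : 𝔤, ⁅x, y⁆ = θ x • LieAlgebra.ad ℝ 𝔤 e₇ y - θ y • LieAlgebra.ad ℝ 𝔤 e₇ x)
    (v : Module.Basis (Fin 6) ℝ 𝔲) {δ : ℤ} {k : ℕ}
    (hv : RescalesBivector k (LinearMap.toMatrix v v (LieModule.toEnd ℝ 𝔤 𝔲 e₇)))
    (E P M : Matrix (Fin 7) (Fin 7) ℤ) (hPE : P * E = 1) (hM0 : ∃ a, M 0 a ≠ 0)
    (hPM : ∀ (i : Fin 6) j, modelMetricInt δ (P i.succ) (M j) = if j = i.succ then 1 else 0)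
    (hM : ∀ i j : Fin 6, modelFormInt δ (M 0) (M i.succ) (M j.succ) = standardAltInt k i j) :
    ∃ (e : Module.Basis (Fin 7) ℝ 𝔤) (Ψ : 𝔤 [⋀^Fin 4]→ₗ[ℝ] ℝ),
      IsHodgeDual (k := 3) (l := 4) (modelMetric δ e) (basisVol e) (modelForm δ e) Ψ ∧
      IsClosedForm (k := 3) Ψ ∧ ∀ i : Fin 6, (v i : 𝔤) = intVector e (P i.succ) := by
  obtain ⟨b, -, hbs⟩ := exists_basis_cons 𝔲 hθ hmem v
  obtain ⟨e, he⟩ := exists_basis_of_intMatrix b E P hPE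
  have hve : ∀ i : Fin 6, (v i : 𝔤) = intVector e (P i.succ) := fun i => by
    rw [← hbs, he]; rfl
  obtain ⟨Ψ, hΨ⟩ := exists_isHodgeDual_modelForm δ e
  refine ⟨e, Ψ, hΨ, ?_, hve⟩
  rw [isClosedForm_iff_rescalesBivector 𝔲 hθ hmem hbr hΨ v (fun i => intVector e (M i)) ?_ ?_
    (k := k) ?_]
  · exact hv
  · obtain ⟨a, ha⟩ := hM0
    intro h
    have := repr_intVector e (M 0) a
    rw [h] at this
    simp only [map_zero, Finsupp.zero_apply] at this
    exact ha (by exact_mod_cast this.symm)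
  · intro i j
    rw [hve, modelMetric_intVector, hPM]
    split_ifs <;> simp
  · intro i j
    rw [modelForm_intVector, hM, standardAltInt_cast]

/-- The coordinates of `e₇, v₁, …, v₆` in an adapted basis for which the ideal is
non-degenerate. -/
def nondegenerateFrame (δ : ℤ) : Matrix (Fin 7) (Fin 7) ℤ :=
  !![0, 0, 0, 0, 0, 0, 1; 1, 0, 0, 0, 0, 0, 0; 0, δ, 0, 0, 0, 0, 0; 0, 0, 1, 0, 0, 0, 0;
    0, 0, 0, δ, 0, 0, 0; 0, 0, 0, 0, 1, 0, 0; 0, 0, 0, 0, 0, 1, 0]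

theorem exists_closed_of_rescalesBivector_three (𝔲 : LieIdeal ℝ 𝔤) {θ : Module.Dual ℝ 𝔤} {e₇ : 𝔤}
    (hθ : θ e₇ = 1) (hmem : ∀ x, θ x = 0 ↔ x ∈ 𝔲)
    (hbr : ∀ x y : 𝔤, ⁅x, y⁆ = θ x • LieAlgebra.ad ℝ 𝔤 e₇ y - θ y • LieAlgebra.ad ℝ 𝔤 e₇ x)
    (v : Module.Basis (Fin 6) ℝ 𝔲) {δ : ℤ} (hδ : δ = 1 ∨ δ = -1)
    (hv : RescalesBivector 3 (LinearMap.toMatrix v v (LieModule.toEnd ℝ 𝔤 𝔲 e₇))) :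
    ∃ (e : Module.Basis (Fin 7) ℝ 𝔤) (Ψ : 𝔤 [⋀^Fin 4]→ₗ[ℝ] ℝ),
      IsHodgeDual (k := 3) (l := 4) (modelMetric δ e) (basisVol e) (modelForm δ e) Ψ ∧
      IsClosedForm (k := 3) Ψ ∧ ((modelMetric δ e).restrict 𝔲.toSubmodule).Nondegenerate := by
  -- The normal vector is the last adapted vector, whose contraction is `δ e¹² + δ e³⁴ + e⁵⁶`. The
  -- factors `δ` normalize it to the standard form; as `δ² = 1`, the frame is orthogonal and its
  -- transpose is its inverse.
  obtain ⟨e, Ψ, hΨ, hcl, hve⟩ := exists_closed_of_rescalesBivector 𝔲 hθ hmem hbr v hv (δ := δ)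
    (nondegenerateFrame δ).transpose (nondegenerateFrame δ)
    !![0, 0, 0, 0, 0, 0, 1; δ, 0, 0, 0, 0, 0, 0; 0, 1, 0, 0, 0, 0, 0; 0, 0, δ, 0, 0, 0, 0;
      0, 0, 0, 1, 0, 0, 0; 0, 0, 0, 0, 1, 0, 0; 0, 0, 0, 0, 0, 1, 0]
    (by rcases hδ with rfl | rfl <;> decide +kernel)
    (by rcases hδ with rfl | rfl <;> decide +kernel)
    (by rcases hδ with rfl | rfl <;> decide +kernel)
    (by rcases hδ with rfl | rfl <;> decide +kernel)
  refine ⟨e, Ψ, hΨ, hcl, ?_⟩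
  have hg : ∀ i j : Fin 6, modelMetric δ e (v i) (v j) =
      if i = j then (metricSign δ i.castSucc : ℝ) else 0 := by
    have : ∀ i j : Fin 6, modelMetricInt δ (nondegenerateFrame δ i.succ)
        (nondegenerateFrame δ j.succ) = if i = j then metricSign δ i.castSucc else 0 := by
      rcases hδ with rfl | rfl <;> decide +kernel
    intro i j
    rw [hve, hve, modelMetric_intVector, this]
    split_ifs <;> simp
  have hleft : ∀ x : 𝔲, (∀ y : 𝔲, modelMetric δ e x y = 0) → x = 0 := by
    intro x hx
    refine v.ext_elem fun i => ?_
    have h1 := hx (v i)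
    have h2 : (x : 𝔤) = ∑ j, v.repr x j • (v j : 𝔤) := by
      conv_lhs => rw [← v.sum_repr x]
      exact map_sum 𝔲.toSubmodule.subtype (fun j => v.repr x j • v j) Finset.univ
    rw [h2] at h1
    simp only [map_sum, map_smul, LinearMap.sum_apply, LinearMap.smul_apply, hg, smul_eq_mul] at h1
    rw [Finset.sum_eq_single i (fun j _ hj => by simp [hj]) (by simp)] at h1
    simp only [if_true] at h1
    rw [(mul_eq_zero.1 h1).resolve_right
      (left_ne_zero_of_mul_eq_one (metricSign_mul_self hδ i.castSucc))]
    simp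
  exact ⟨fun x hx => hleft x hx, fun x hx => hleft x fun y => by
    rw [modelMetric_comm]; exact hx y⟩

theorem exists_closed_of_rescalesBivector_two (𝔲 : LieIdeal ℝ 𝔤) {θ : Module.Dual ℝ 𝔤} {e₇ : 𝔤}
    (hθ : θ e₇ = 1) (hmem : ∀ x, θ x = 0 ↔ x ∈ 𝔲)
    (hbr : ∀ x y : 𝔤, ⁅x, y⁆ = θ x • LieAlgebra.ad ℝ 𝔤 e₇ y - θ y • LieAlgebra.ad ℝ 𝔤 e₇ x)
    (v : Module.Basis (Fin 6) ℝ 𝔲)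
    (hv : RescalesBivector 2 (LinearMap.toMatrix v v (LieModule.toEnd ℝ 𝔤 𝔲 e₇))) :
    ∃ (e : Module.Basis (Fin 7) ℝ 𝔤) (Ψ : 𝔤 [⋀^Fin 4]→ₗ[ℝ] ℝ),
      IsHodgeDual (k := 3) (l := 4) (modelMetric (-1) e) (basisVol e) (modelForm (-1) e) Ψ ∧
      IsClosedForm (k := 3) Ψ := by
  -- Numbering adapted vectors from zero, the normal is the null vector `e₀ + e₆`, which equals
  -- `-v₂` and so lies in `𝔲`. The kernel of its contraction is the isotropic space spanned by `e₀ +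
  -- e₆`, `e₂ + e₅` and `e₃ + e₄`; the last two are the final rows of `M`.
  obtain ⟨e, Ψ, hΨ, hcl, -⟩ := exists_closed_of_rescalesBivector 𝔲 hθ hmem hbr v hv (δ := -1)
    !![-1, 0, -1, 0, 0, 0, 0; 0, -1, 0, 0, 0, 0, 0; 0, 0, 0, -1, 0, -1, 0; 0, 0, 0, 0, 0, 0, -1;
      0, 0, 0, 0, 1, 0, 1; 0, 0, 0, 0, 0, 1, 0; 1, 0, 0, 0, 0, 0, 0]
    !![0, 0, 0, 0, 0, 0, 1; 0, -1, 0, 0, 0, 0, 0; -1, 0, 0, 0, 0, 0, -1; 0, 0, -1, 0, 0, -1, 0;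
      0, 0, 0, 1, 1, 0, 0; 0, 0, 0, 0, 0, 1, 0; 0, 0, 0, -1, 0, 0, 0]
    !![1, 0, 0, 0, 0, 0, 1; 0, 1, 0, 0, 0, 0, 0; 1, 0, 0, 0, 0, 0, 0; 0, 0, 1, 0, 0, 0, 0;
      0, 0, 0, 0, 1, 0, 0; 0, 0, 1, 0, 0, 1, 0; 0, 0, 0, 1, 1, 0, 0]
    (by decide +kernel) (by decide +kernel) (by decide +kernel) (by decide +kernel)
  exact ⟨e, Ψ, hΨ, hcl⟩

end Constructions

/-! ### Cocalibrated structures in terms of the model metric. -/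

section Cocalibrated

variable {𝔤 : Type*} [LieRing 𝔤] [LieAlgebra ℝ 𝔤]

/-- The induced metric and volume form are unique, being fixed on any one adapted basis, so they may
be replaced by the model ones. -/
theorem isCocalibratedG2_iff (φ : 𝔤 [⋀^Fin 3]→ₗ[ℝ] ℝ) :
    IsCocalibratedG2 φ ↔ ∃ (e : Module.Basis (Fin 7) ℝ 𝔤) (Ψ : 𝔤 [⋀^Fin 4]→ₗ[ℝ] ℝ),
      φ = modelForm 1 e ∧
      IsHodgeDual (k := 3) (l := 4) (modelMetric 1 e) (basisVol e) (modelForm 1 e) Ψ ∧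
      IsClosedForm (k := 3) Ψ := by
  constructor
  · rintro ⟨⟨e, rfl⟩, g, vol, Ψ, hind, hΨ, hcl⟩
    rw [isInducedByG2_iff, ← modelForm_one] at hind
    obtain ⟨rfl, rfl⟩ := hind.eq_model
    rw [← modelForm_one] at hΨ ⊢
    exact ⟨e, Ψ, rfl, hΨ, hcl⟩
  · rintro ⟨e, Ψ, rfl, hΨ, hcl⟩
    exact ⟨⟨e, modelForm_one e⟩, _, _, Ψ,
      (isInducedByG2_iff _ _ _).2 (isInduced_modelForm (Or.inl rfl) e), hΨ, hcl⟩

theorem isCocalibratedG2Star_iff (φ : 𝔤 [⋀^Fin 3]→ₗ[ℝ] ℝ) :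
    IsCocalibratedG2Star φ ↔ ∃ (e : Module.Basis (Fin 7) ℝ 𝔤) (Ψ : 𝔤 [⋀^Fin 4]→ₗ[ℝ] ℝ),
      φ = modelForm (-1) e ∧
      IsHodgeDual (k := 3) (l := 4) (modelMetric (-1) e) (basisVol e) (modelForm (-1) e) Ψ ∧
      IsClosedForm (k := 3) Ψ := by
  constructor
  · rintro ⟨⟨e, rfl⟩, g, vol, Ψ, hind, hΨ, hcl⟩
    rw [isInducedByG2Star_iff, ← modelForm_neg_one] at hind
    obtain ⟨rfl, rfl⟩ := hind.eq_model
    rw [← modelForm_neg_one] at hΨ ⊢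
    exact ⟨e, Ψ, rfl, hΨ, hcl⟩
  · rintro ⟨e, Ψ, rfl, hΨ, hcl⟩
    exact ⟨⟨e, modelForm_neg_one e⟩, _, _, Ψ,
      (isInducedByG2Star_iff _ _ _).2 (isInduced_modelForm (Or.inr rfl) e), hΨ, hcl⟩

theorem isNondegenerateForG2Star_modelForm_iff {V : Type*} [AddCommGroup V] [Module ℝ V]
    (e : Module.Basis (Fin 7) ℝ V) (U : Submodule ℝ V) :
    IsNondegenerateForG2Star (modelForm (-1) e) U ↔
      ((modelMetric (-1) e).restrict U).Nondegenerate := by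
  constructor
  · rintro ⟨g, vol, hind, hU⟩
    rw [isInducedByG2Star_iff] at hind
    rwa [hind.eq_model.1] at hU
  · intro h
    exact ⟨_, _, (isInducedByG2Star_iff _ _ _).2 (isInduced_modelForm (Or.inr rfl) e), h⟩

end Cocalibrated

/-! ### The classification. -/

theorem mainTheorem5 {𝔤 : Type*} [LieRing 𝔤] [LieAlgebra ℝ 𝔤]
    (h𝔤 : Module.finrank ℝ 𝔤 = 7)
    (𝔲 : LieIdeal ℝ 𝔤) (h𝔲 : Module.finrank ℝ 𝔲 = 6) (h𝔲_abelian : IsLieAbelian 𝔲)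
    (e₇ : 𝔤) (he₇ : e₇ ∉ 𝔲)
    (ω₆ : LinearMap.BilinForm ℝ 𝔲) (hω₆_alt : ω₆.IsAlt) (hω₆ : ω₆.Nondegenerate)
    (V₄ V₂ : Submodule ℝ 𝔲) (hV₄ : Module.finrank ℝ V₄ = 4) (hV₂ : Module.finrank ℝ V₂ = 2)
    (hV : IsCompl V₂ V₄)
    (ω₄ : LinearMap.BilinForm ℝ V₄) (hω₄_alt : ω₄.IsAlt) (hω₄ : ω₄.Nondegenerate) :
    (((∃ φ : 𝔤 [⋀^Fin 3]→ₗ[ℝ] ℝ, IsCocalibratedG2 φ) ↔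
        (∃ φ : 𝔤 [⋀^Fin 3]→ₗ[ℝ] ℝ, IsCocalibratedG2Star φ ∧
          IsNondegenerateForG2Star φ 𝔲.toSubmodule)) ∧
      ((∃ φ : 𝔤 [⋀^Fin 3]→ₗ[ℝ] ℝ, IsCocalibratedG2 φ) ↔
        IsSimilarToElementOf (LieModule.toEnd ℝ 𝔤 𝔲 e₇) (symplecticAlgebra ω₆))) ∧
    ((∃ φ : 𝔤 [⋀^Fin 3]→ₗ[ℝ] ℝ, IsCocalibratedG2Star φ) ↔
      (IsSimilarToElementOf (LieModule.toEnd ℝ 𝔤 𝔲 e₇) (symplecticAlgebra ω₆) ∨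
        IsSimilarToElementOf (LieModule.toEnd ℝ 𝔤 𝔲 e₇) (lengthTwoStabilizer V₂ V₄ ω₄))) := by
  obtain ⟨θ, hθ, hmem, hbr⟩ := exists_dual_of_abelian_ideal h𝔤 𝔲 h𝔲 h𝔲_abelian e₇ he₇
  rw [isSimilarToElementOf_symplecticAlgebra_iff h𝔲 ω₆ hω₆_alt hω₆,
    isSimilarToElementOf_lengthTwoStabilizer_iff hV₄ hV₂ hV ω₄ hω₄_alt hω₄]
  have hn : ∀ {δ : ℤ} (_ : δ = 1 ∨ δ = -1) (e : Module.Basis (Fin 7) ℝ 𝔤), sharp δ e θ ≠ 0 :=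
    fun {δ} hδ e h => by
      have := modelMetric_sharp hδ e θ e₇
      rw [h, hθ] at this
      simp at this
  have hG2 : (∃ φ : 𝔤 [⋀^Fin 3]→ₗ[ℝ] ℝ, IsCocalibratedG2 φ) ↔
      ∃ v : Module.Basis (Fin 6) ℝ 𝔲,
        RescalesBivector 3 (LinearMap.toMatrix v v (LieModule.toEnd ℝ 𝔤 𝔲 e₇)) := by
    constructor
    · rintro ⟨φ, hφ⟩
      obtain ⟨e, Ψ, -, hΨ, hcl⟩ := (isCocalibratedG2_iff φ).1 hφ
      obtain ⟨k, v, -, hk, hv⟩ :=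
        exists_rescalesBivector_of_closed 𝔲 hθ hmem hbr h𝔲 (Or.inl rfl) hΨ hcl
      obtain rfl := hk (modelMetric_one_self_ne_zero e (hn (Or.inl rfl) e))
      exact ⟨v, hv⟩
    · rintro ⟨v, hv⟩
      obtain ⟨e, Ψ, hΨ, hcl, -⟩ :=
        exists_closed_of_rescalesBivector_three 𝔲 hθ hmem hbr v (Or.inl rfl) hv
      exact ⟨_, (isCocalibratedG2_iff _).2 ⟨e, Ψ, rfl, hΨ, hcl⟩⟩
  have hStar : (∃ φ : 𝔤 [⋀^Fin 3]→ₗ[ℝ] ℝ, IsCocalibratedG2Star φ ∧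
      IsNondegenerateForG2Star φ 𝔲.toSubmodule) ↔
      ∃ v : Module.Basis (Fin 6) ℝ 𝔲,
        RescalesBivector 3 (LinearMap.toMatrix v v (LieModule.toEnd ℝ 𝔤 𝔲 e₇)) := by
    constructor
    · rintro ⟨φ, hφ, hnd⟩
      obtain ⟨e, Ψ, rfl, hΨ, hcl⟩ := (isCocalibratedG2Star_iff φ).1 hφ
      rw [isNondegenerateForG2Star_modelForm_iff] at hnd
      obtain ⟨k, v, -, hk, hv⟩ :=
        exists_rescalesBivector_of_closed 𝔲 hθ hmem hbr h𝔲 (Or.inr rfl) hΨ hcl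
      -- If `g(n, n) = θ(n) = 0`, then `n` lies in `𝔲` and is orthogonal to it, contradicting
      -- non-degeneracy.
      obtain rfl := hk fun h0 => by
        rw [modelMetric_sharp (Or.inr rfl), hmem] at h0
        have h1 := hnd.1 ⟨_, h0⟩ fun y =>
          (modelMetric_sharp (Or.inr rfl) e θ y).trans ((hmem _).2 y.2)
        exact hn (Or.inr rfl) e (congrArg Subtype.val h1)
      exact ⟨v, hv⟩
    · rintro ⟨v, hv⟩
      obtain ⟨e, Ψ, hΨ, hcl, hnd⟩ :=
        exists_closed_of_rescalesBivector_three 𝔲 hθ hmem hbr v (Or.inr rfl) hv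
      exact ⟨_, (isCocalibratedG2Star_iff _).2 ⟨e, Ψ, rfl, hΨ, hcl⟩,
        (isNondegenerateForG2Star_modelForm_iff e _).2 hnd⟩
  refine ⟨⟨hG2.trans hStar.symm, hG2⟩, ?_, ?_⟩
  · rintro ⟨φ, hφ⟩
    obtain ⟨e, Ψ, -, hΨ, hcl⟩ := (isCocalibratedG2Star_iff φ).1 hφ
    obtain ⟨k, v, rfl | rfl, -, hv⟩ :=
      exists_rescalesBivector_of_closed 𝔲 hθ hmem hbr h𝔲 (Or.inr rfl) hΨ hcl
    · exact Or.inr ⟨v, hv⟩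
    · exact Or.inl ⟨v, hv⟩
  · rintro (h | ⟨v, hv⟩)
    · obtain ⟨φ, hφ, -⟩ := hStar.2 h
      exact ⟨φ, hφ⟩
    · obtain ⟨e, Ψ, hΨ, hcl⟩ := exists_closed_of_rescalesBivector_two 𝔲 hθ hmem hbr v hv
      exact ⟨_, (isCocalibratedG2Star_iff _).2 ⟨e, Ψ, rfl, hΨ, hcl⟩⟩
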